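/- Let $n\ge 1$ and $0\le k\le n$, put $s=\min(k,n-k)$, let $X$ be the set of $k$-subsets of $\{1,\dots,n\}$, and let $\mathcal F$ be the space of functions $X\to\mathbb C$ with the inner product for which the delta functions are orthonormal; denote by $B_0$ the basis of delta functions. The group $S_n$ acts on $\mathcal F$ by $\sigma f=f\circ\sigma^{-1}$; for $1\le i\le n$ let $S_i\subseteq S_n$ be the subgroup fixing $i+1,\dots,n$, and for $0\le a\le i/2$ let $\mathcal F_{i,(i-a,a)}$ be the isotypic component of $\mathcal F$ under $S_i$ belonging to the irreducible (Specht) representation of shape $(i-a,a)$. Put $\mathcal F_a=\mathcal F_{n,(n-a,a)}$. Every $f\in\mathcal F$ can be written in exactly one way as $f=\sum_{a=0}^{s}f_a$ with $f_a\in\mathcal F_a$; the numbers $\|f_a\|^2$ are the weights of $f$. Identify a $k$-subset with the word of length $n$ in the letters $1,2$ that has the letter $1$ exactly at the elements of the subset. For $1\le i\le n$, consider the pairs $(T,w)$ where $w$ is a word of length $n-i$ in the letters $1,2$ with $k-r$ letters $1$, $0\le r\le k$, and $T$ is a standard Young tableau with $i$ boxes of shape $(i-a,a)$, $0\le a\le\min(r,i-r)$,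 regarded as a chain $\lambda_1\nearrow\dots\nearrow\lambda_i$ of Young diagrams. Let $\mathcal F^{w}$ be the span of the delta functions of the words that end in $w$, and $\mathcal F^w_T=\mathcal F_{1,\lambda_1}\cap\dots\cap\mathcal F_{i,\lambda_i}\cap\mathcal F^w$. There are orthonormal bases $B_1,\dots,B_n$ of $\mathcal F$ such that $B_i$ consists of one vector of $\mathcal F^w_T$ for each such pair $(T,w)$, and $B_1=B_0$ (so $B_n$ is a Gelfand–Tsetlin basis). For $2\le i\le n$ let $[B_{i-1}]_{B_i}$ be the matrix whose columns are the coordinates of the elements of $B_{i-1}$ in the basis $B_i$. Count as one operation on complex numbers a multiplication together with an addition, $u+vw$ or $u+v\bar v$. Then, for each pair $(n,k)$, there is a straight-line program with at most $(2n-1)\binom nk$ operations which, for every such choice of $B_1,\dots,B_n$ and every $f\in\mathcal F$, takes as input the entries of the column vector $[f]_{B_0}$ and the entries of the matrices $[B_{i-1}]_{B_i}$, $i=2,\dots,n$, and whose output consists of all the weights $\|f_a\|^2$, $a=0,\dots,s$. (Each operand of an operation is $0$, an input or the result of an earlier operation.) -/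

import Mathlib

noncomputable section

namespace JohnsonFFT

/-! ### Functions on the Johnson graph

The ground set `{1, …, n}` is `Fin n`, so the element `j` of the text is `j - 1` here. -/

/-- The set `X` of `k`-subsets of an `n`-set. -/
abbrev KSet (n k : ℕ) : Type := Set.powersetCard (Fin n) k

/-- The space `𝓕` of complex functions on `X`, with the inner product for which the delta
functions are orthonormal. -/
abbrev FunSpace (n k : ℕ) : Type := EuclideanSpace ℂ (KSet n k)

/-- The delta function at `x`. -/
def delta {n k : ℕ} (x : KSet n k) : FunSpace n k :=
  open Classical in EuclideanSpace.single x 1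

/-- The action `σ f = f ∘ σ⁻¹` of the symmetric group on functions. -/
def permRep (n k : ℕ) : Representation ℂ (Equiv.Perm (Fin n)) (FunSpace n k) where
  toFun σ :=
    { toFun := fun f => WithLp.toLp 2 fun x => f (σ⁻¹ • x)
      map_add' := fun f g => by ext x; simp
      map_smul' := fun c f => by ext x; simp }
  map_one' := by ext f x; simp
  map_mul' σ τ := by ext f x; simp [mul_smul]

/-- `𝓕` as a representation of `S_i`, acting on the first `i` elements of the ground set and
fixing the last `n - i`. -/
def stageRep (n k i : ℕ) (hi : i ≤ n) : Representation ℂ (Equiv.Perm (Fin i)) (FunSpace n k) :=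
  (permRep n k).comp (Equiv.Perm.viaEmbeddingHom (Fin.castLEEmb hi))

/-! ### The irreducible representation of `S_m` of shape `(m - a, a)`

A tabloid of shape `(m - a, a)` is determined by its second row, an `a`-subset of the ground set,
so the permutation module on tabloids is `FunSpace m a`. We use the tableau whose first row is
`0, …, m - a - 1` and whose second row is `m - a, …, m - 1`. -/

/-- The column of the entry `x` in the tableau. -/
def column (m a : ℕ) (x : Fin m) : ℕ := if (x : ℕ) < m - a then x else x - (m - a)

/-- The second row of the tableau. -/
def secondRow (m a : ℕ) : Finset (Fin m) := Finset.univ.filter fun x => m - a ≤ (x : ℕ)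

/-- The column stabilizer of the tableau. -/
def columnGroup (m a : ℕ) : Finset (Equiv.Perm (Fin m)) :=
  Finset.univ.filter fun π => ∀ x, column m a (π x) = column m a x

/-- The polytabloid of the tableau: the signed sum of the translates, by the column stabilizer,
of the tabloid of the tableau. -/
def polytabloid (m a : ℕ) : FunSpace m a :=
  WithLp.toLp 2 fun x => ∑ π ∈ columnGroup m a,
    if (x : Finset (Fin m)) = (secondRow m a).image π then ((Equiv.Perm.sign π : ℤ) : ℂ) else 0

/-- The Specht module of shape `(m - a, a)` (for `2 * a ≤ m`): the span of all polytabloids, that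
is, of all translates of the one above. -/
def specht (m a : ℕ) : Subrepresentation (permRep m a) where
  toSubmodule := Submodule.span ℂ (Set.range fun σ => permRep m a σ (polytabloid m a))
  apply_mem_toSubmodule := by
    intro g v hv
    induction hv using Submodule.span_induction with
    | mem x hx =>
      obtain ⟨σ, rfl⟩ := hx
      exact Submodule.subset_span ⟨g * σ, by simp⟩
    | zero => simp
    | add x y _ _ hx hy => rw [map_add]; exact add_mem hx hy
    | smul c x _ hx => rw [map_smul]; exact Submodule.smul_mem _ c hx

/-- The isotypic component `𝓕_{i, λ}` of `𝓕` under `S_i`, for `λ = (i - a, a)`: the sum of all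
subrepresentations of `𝓕` that are isomorphic to the Specht module of shape `λ`. -/
def isotypic (n k i : ℕ) (hi : i ≤ n) (a : ℕ) : Submodule ℂ (FunSpace n k) :=
  ⨆ (φ : (specht i a).toRepresentation.IntertwiningMap (stageRep n k i hi))
    (_ : Function.Injective φ.toLinearMap), LinearMap.range φ.toLinearMap

/-- `f = ∑ f_a`, with `f_a` in the isotypic component of shape `(n - a, a)` under `S_n`, where `a`
runs from `0` to `s = min k (n - k)`. -/
def IsDecomposition {n k : ℕ} (f : FunSpace n k) (g : Fin (min k (n - k) + 1) → FunSpace n k) :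
    Prop :=
  (∀ a : Fin (min k (n - k) + 1), g a ∈ isotypic n k n le_rfl (a : ℕ)) ∧ f = ∑ a, g a

/-! ### The intermediate bases -/

/-- The labels of the basis `B_i`: pairs `(T, w)` of a standard tableau `T` with `i` boxes and at
most two rows, and a word `w` of length `n - i` in the letters `1`, `2`. -/
structure Label (n k i : ℕ) where
  /-- The entries in the second row of `T`. -/
  second : Finset (Fin n)
  /-- The places, among the last `n - i`, where `w` has the letter `1`. -/
  ones : Finset (Fin n)
  second_lt : ∀ x ∈ second, (x : ℕ) < i
  le_ones : ∀ x ∈ ones, i ≤ (x : ℕ)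
  /-- For every `j ≤ i` the entries `1, …, j` fill a Young diagram. -/
  standard : ∀ j ≤ i, 2 * (second.filter fun x : Fin n => (x : ℕ) < j).card ≤ j
  /-- `a ≤ r`, for the shape `(i - a, a)` of `T` and the number `r = k - #ones` of letters `1`
  missing from `w`. -/
  shape_le : second.card + ones.card ≤ k
  /-- `a ≤ i - r`. -/
  shape_le' : second.card + k ≤ i + ones.card

namespace Label

theorem ext_pair {n k i : ℕ} :
    Function.Injective fun l : Label n k i => (l.second, l.ones) := by
  rintro ⟨⟩ ⟨⟩ h
  simp only [Prod.mk.injEq] at h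
  obtain ⟨rfl, rfl⟩ := h
  rfl

instance (n k i : ℕ) : Fintype (Label n k i) := Fintype.ofInjective _ ext_pair

/-- The length of the second row of the `j`-th shape `λ_j = (j - a_j, a_j)` in the chain
`λ_1 ↗ ⋯ ↗ λ_i` that is the tableau. -/
def secondLength {n k i : ℕ} (l : Label n k i) (j : ℕ) : ℕ :=
  (l.second.filter fun x : Fin n => (x : ℕ) < j).card

/-- The subspace `𝓕^w`, spanned by the delta functions of the `k`-sets whose word ends in `w`. -/
def wordSpace {n k i : ℕ} (l : Label n k i) : Submodule ℂ (FunSpace n k) :=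
  Submodule.span ℂ
    (delta '' {x : KSet n k | ∀ y : Fin n, i ≤ (y : ℕ) → (y ∈ x ↔ y ∈ l.ones)})

/-- The subspace `𝓕^w_{λ_1 ↗ ⋯ ↗ λ_i} = 𝓕_{1, λ_1} ∩ ⋯ ∩ 𝓕_{i, λ_i} ∩ 𝓕^w`. -/
def space {n k i : ℕ} (hi : i ≤ n) (l : Label n k i) : Submodule ℂ (FunSpace n k) :=
  (⨅ (j : ℕ) (_ : 1 ≤ j) (hj : j ≤ i), isotypic n k j (hj.trans hi) (l.secondLength j)) ⊓
    l.wordSpace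

end Label

/-- A choice of the orthonormal bases `B_1, …, B_n` of `𝓕`; the basis `B_{i+1}` is `basis i`.
Each is made of unit vectors of the subspaces `𝓕^w_{λ_1 ↗ ⋯ ↗ λ_i}`, and `B_1` is the basis `B_0`
of delta functions. The basis `B_n` is a Gelfand-Tsetlin basis of `𝓕`. -/
structure IntermediateBases (n k : ℕ) where
  basis : ∀ i : Fin n, OrthonormalBasis (Label n k (i + 1)) ℂ (FunSpace n k)
  mem_space : ∀ (i : Fin n) (l : Label n k (i + 1)), basis i l ∈ l.space i.isLt
  first : ∀ (h : 0 < n) (l : Label n k (0 + 1)), ∃ x : KSet n k, basis ⟨0, h⟩ l = delta x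

/-- The change of basis matrix `[B_{i+1}]_{B_{i+2}}`, whose columns are the coordinates of the
elements of `B_{i+1}` in the basis `B_{i+2}`. -/
def IntermediateBases.factor {n k : ℕ} (B : IntermediateBases n k) (i : ℕ) (hi : i + 1 < n) :
    Matrix (Label n k (i + 1 + 1)) (Label n k (i + 1)) ℂ :=
  (B.basis ⟨i + 1, hi⟩).toBasis.toMatrix (B.basis ⟨i, Nat.lt_of_succ_lt hi⟩)

/-! ### Straight-line programs

One operation is one complex multiplication together with one addition. -/

/-- What an operation may read: the number `0`, an input variable, or the result of the `j`-th
operation (an operation that has not been performed yet reads as `0`). -/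
inductive Operand (I : Type) where
  | zero
  | input (v : I)
  | result (j : ℕ)

/-- An operation `u + v * w`, or `u + v * conj v = u + |v|²`. -/
inductive Op (I : Type) where
  | mulAdd (u v w : Operand I)
  | normSqAdd (u v : Operand I)

/-- The value of an operand, given the input and the list of the results so far. -/
def Operand.eval {I : Type} (inp : I → ℂ) (mem : List ℂ) : Operand I → ℂ
  | .zero => 0
  | .input v => inp v
  | .result j => mem.getD j 0

/-- The result of an operation, given the input and the list of the results so far. -/
def Op.eval {I : Type} (inp : I → ℂ) (mem : List ℂ) : Op I → ℂ
  | .mulAdd u v w => u.eval inp mem + v.eval inp mem * w.eval inp mem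
  | .normSqAdd u v => u.eval inp mem + v.eval inp mem * (starRingEnd ℂ) (v.eval inp mem)

/-- A program with inputs `I` and outputs `O`: the list of the operations, performed in this
order, and for each output where to find it. -/
structure Program (I O : Type) where
  ops : List (Op I)
  out : O → Operand I

/-- The list of the results of all the operations. -/
def Program.results {I O : Type} (P : Program I O) (inp : I → ℂ) : List ℂ :=
  P.ops.foldl (fun mem c => mem ++ [c.eval inp mem]) []

/-- The outputs of the program. -/
def Program.run {I O : Type} (P : Program I O) (inp : I → ℂ) (o : O) : ℂ :=
  (P.out o).eval inp (P.results inp)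

/-- The number of operations. -/
def Program.cost {I O : Type} (P : Program I O) : ℕ := P.ops.length

/-- The input variables: the entries of `[f]_{B_0}` and those of the matrices
`[B_{i+1}]_{B_{i+2}}`. -/
inductive InputVar (n k : ℕ) where
  | coord (x : KSet n k)
  | entry (i : ℕ) (hi : i + 1 < n) (row : Label n k (i + 1 + 1)) (col : Label n k (i + 1))

/-- The values of the input variables. -/
def inputOf {n k : ℕ} (B : IntermediateBases n k) (f : FunSpace n k) : InputVar n k → ℂ
  | .coord x => f x
  | .entry i hi row col => B.factor i hi row col

end JohnsonFFT

end

/-!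
Functions of `k`-sets are treated as functions of all finite sets, on which adjoining and removing
an element are linear operators. The commutator of the raising operator `R` and the lowering
operator `L` is a scalar on each slice (`sl₂`-theory), so `R ^ m` is injective on the part of
`ker L` in the lower half. The sum of `(x y)` over all ordered pairs of the first `j` elements
equals `2 R L` plus a scalar on each slice. Products `∏ (δ_x - δ_y)` lie in `ker L` and span the
Specht module, so this sum acts on the isotypic component of shape `(j - a, a)` by a scalar which
determines `a`.

Starting from the empty set, a standard tableau with two rows prescribes a vector of `ker L`: an
element of the first row does not change the vector, an element of the second row is adjoined and
the result projected to `ker L`. Raising this vector and adjoining the remaining word `w` gives a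
nonzero element of `𝓕^w_T`. Vectors with different labels are orthogonal, by the eigenvalues of the
sums of transpositions, and there are enough labels, by induction on `i`, to give a basis.

A vector of `B_{i-1}` is orthogonal to a vector of `B_i` unless the two labels differ only at the
element `i`, so each row of `[B_{i-1}]_{B_i}` has at most two nonzero entries. Each of the `n - 1`
changes of basis thus takes at most `2 * n.choose k` operations, and the squared norms of the
components another `n.choose k`.
-/

noncomputable section

namespace JohnsonFFT

open Finset Equiv
open scoped Pointwise

/-! ### Raising and lowering operators -/

section Operators

variable {α R : Type*} [DecidableEq α] [CommRing R]

/-- Adjoining `w` to the argument: `adjoin w` maps `δ_z` to `δ_{z ∪ w}` if `z` is disjoint from `w`,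
and to `0` otherwise. -/
def adjoin (w : Finset α) : Module.End R (Finset α → R) where
  toFun f z := if w ⊆ z then f (z \ w) else 0
  map_add' f g := by ext z; by_cases h : w ⊆ z <;> simp [h]
  map_smul' c f := by ext z; by_cases h : w ⊆ z <;> simp [h]

/-- Removing `x` from the argument: `contract x` maps `δ_z` to `δ_{z \ {x}}` if `x ∈ z`, and to `0`
otherwise. -/
def contract (x : α) : Module.End R (Finset α → R) where
  toFun f z := if x ∈ z then 0 else f (insert x z)
  map_add' f g := by ext z; by_cases h : x ∈ z <;> simp [h]
  map_smul' c f := by ext z; by_cases h : x ∈ z <;> simp [h]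

/-- The raising operator, which adjoins an element of `s` in all possible ways. -/
def raise (s : Finset α) : Module.End R (Finset α → R) := ∑ x ∈ s, adjoin {x}

/-- The lowering operator, which removes an element of `s` in all possible ways. -/
def lower (s : Finset α) : Module.End R (Finset α → R) := ∑ x ∈ s, contract x

/-- The action of permutations on functions of finite sets. -/
def relabel (σ : Perm α) : Module.End R (Finset α → R) where
  toFun f z := f (σ⁻¹ • z)
  map_add' f g := by ext z; simp
  map_smul' c f := by ext z; simp

/-- The sum of `(x y)` over all ordered pairs of elements of `s`, including `x = y`. -/
def swapSum (s : Finset α) : Module.End R (Finset α → R) :=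
  ∑ x ∈ s, ∑ y ∈ s, relabel (swap x y)

/-- The functions supported on the `a`-subsets of `s`. -/
def sliceSpace (R : Type*) [CommRing R] (s : Finset α) (a : ℕ) :
    Submodule R (Finset α → R) where
  carrier := {f | ∀ z, f z ≠ 0 → z ⊆ s ∧ #z = a}
  zero_mem' _ h := (h rfl).elim
  add_mem' {f g} hf hg z h := by
    by_contra hz
    exact h (by simp [not_imp_comm.1 (hf z) hz, not_imp_comm.1 (hg z) hz])
  smul_mem' c f hf z h := hf z (right_ne_zero_of_mul h)

theorem adjoin_apply (w : Finset α) (f : Finset α → R) (z : Finset α) :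
    adjoin w f z = if w ⊆ z then f (z \ w) else 0 := rfl

theorem contract_apply (x : α) (f : Finset α → R) (z : Finset α) :
    contract x f z = if x ∈ z then 0 else f (insert x z) := rfl

theorem relabel_apply (σ : Perm α) (f : Finset α → R) (z : Finset α) :
    relabel σ f z = f (σ⁻¹ • z) := rfl

theorem commute_contract_adjoin {x : α} {w : Finset α} (h : x ∉ w) :
    Commute (contract x : Module.End R (Finset α → R)) (adjoin w) := by
  ext1 f
  ext z
  simp only [Module.End.mul_apply, adjoin_apply, contract_apply, subset_insert_iff_of_notMem h,
    insert_sdiff_of_notMem _ h, mem_sdiff, h, not_false_eq_true, and_true]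
  split_ifs <;> rfl

theorem contract_adjoin_self (x : α) (f : Finset α → R) (z : Finset α) :
    contract x (adjoin {x} f) z =
      adjoin {x} (contract x f) z + (1 - 2 * if x ∈ z then 1 else 0) * f z := by
  by_cases h : x ∈ z
  · simp [adjoin_apply, contract_apply, h]
    ring
  · simp [adjoin_apply, contract_apply, h, sdiff_singleton_eq_erase]

theorem commute_lower_adjoin {s w : Finset α} (h : Disjoint s w) :
    Commute (lower s : Module.End R (Finset α → R)) (adjoin w) :=
  Commute.sum_left _ _ _ fun _ hx => commute_contract_adjoin (disjoint_left.1 h hx)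

theorem lower_raise (s : Finset α) (f : Finset α → R) (z : Finset α) :
    lower s (raise s f) z = raise s (lower s f) z + (#s - 2 * #(s ∩ z)) * f z := by
  have hcomm : ∀ x y, contract x (adjoin {y} f) z = adjoin {y} (contract x f) z +
      if x = y then (1 - 2 * if x ∈ z then 1 else 0) * f z else 0 := by
    intro x y
    by_cases h : x = y
    · rw [if_pos h, ← h, contract_adjoin_self]
    · rw [if_neg h, add_zero, ← Module.End.mul_apply,
        (commute_contract_adjoin (by rwa [mem_singleton])).eq, Module.End.mul_apply]
  have hcard : ∑ x ∈ s, (1 - 2 * if x ∈ z then 1 else 0 : R) = #s - 2 * #(s ∩ z) := by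
    rw [sum_sub_distrib, ← mul_sum, sum_boole, filter_mem_eq_inter, sum_const, nsmul_one]
  simp only [lower, raise, LinearMap.sum_apply, map_sum, Finset.sum_apply, hcomm, sum_add_distrib,
    ← hcard, sum_mul]
  exact congrArg₂ (· + ·) sum_comm (sum_congr rfl fun x hx => by rw [sum_ite_eq', if_pos hx])

/-! ### Slices -/

theorem adjoin_mem_sliceSpace {s w : Finset α} {a : ℕ} {f : Finset α → R}
    (hf : f ∈ sliceSpace R s a) : adjoin w f ∈ sliceSpace R (s ∪ w) (a + #w) := by
  intro z hz
  rw [adjoin_apply, ite_ne_right_iff] at hz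
  obtain ⟨hs, ha⟩ := hf _ hz.2
  refine ⟨?_, by rw [← ha, card_sdiff_add_card_eq_card hz.1]⟩
  rw [union_comm]
  exact sdiff_le_iff.1 hs

theorem raise_mem_sliceSpace {s : Finset α} {a : ℕ} {f : Finset α → R}
    (hf : f ∈ sliceSpace R s a) : raise s f ∈ sliceSpace R s (a + 1) := by
  rw [raise, LinearMap.sum_apply]
  refine sum_mem fun x hx => ?_
  have := adjoin_mem_sliceSpace (w := {x}) hf
  rwa [union_eq_left.2 (singleton_subset_iff.2 hx), card_singleton] at this

theorem raise_pow_mem_sliceSpace {s : Finset α} {a : ℕ} {f : Finset α → R}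
    (hf : f ∈ sliceSpace R s a) (m : ℕ) : (raise s ^ m) f ∈ sliceSpace R s (a + m) := by
  induction m with
  | zero => exact hf
  | succ m ih => rw [pow_succ', Module.End.mul_apply]; exact raise_mem_sliceSpace ih

theorem eq_zero_of_adjoin_eq_zero {s w : Finset α} {a : ℕ} {f : Finset α → R} (hd : Disjoint s w)
    (hf : f ∈ sliceSpace R s a) (h : adjoin w f = 0) : f = 0 := by
  ext z
  by_contra hz
  have := congrFun h (z ∪ w)
  rw [adjoin_apply, if_pos subset_union_right,
    union_sdiff_cancel_right (hd.mono_left (hf z hz).1)] at this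
  exact hz this

theorem lower_raise_of_mem_sliceSpace {s : Finset α} {a : ℕ} {f : Finset α → R}
    (hf : f ∈ sliceSpace R s a) :
    lower s (raise s f) = raise s (lower s f) + ((#s : R) - 2 * a) • f := by
  ext z
  rw [lower_raise, Pi.add_apply, Pi.smul_apply, smul_eq_mul]
  by_cases hz : f z = 0
  · simp only [hz, mul_zero]
  · rw [inter_eq_right.2 (hf z hz).1, (hf z hz).2]

theorem lower_raise_pow {s : Finset α} {a : ℕ} {f : Finset α → R} (hf : f ∈ sliceSpace R s a)
    (h : lower s f = 0) (m : ℕ) :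
    lower s ((raise s ^ (m + 1)) f) = (((m : R) + 1) * (#s - 2 * a - m)) • (raise s ^ m) f := by
  induction m with
  | zero => simp [lower_raise_of_mem_sliceSpace hf, h]
  | succ m ih =>
    rw [pow_succ', Module.End.mul_apply,
      lower_raise_of_mem_sliceSpace (raise_pow_mem_sliceSpace hf (m + 1)), ih, map_smul,
      ← Module.End.mul_apply, ← pow_succ', ← add_smul]
    congr 1
    push_cast
    ring

theorem eq_zero_of_raise_pow_eq_zero [NoZeroDivisors R] [CharZero R] {s : Finset α} {a m : ℕ}
    {f : Finset α → R} (hf : f ∈ sliceSpace R s a) (h : lower s f = 0) (hm : 2 * a + m ≤ #s)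
    (h0 : (raise s ^ m) f = 0) : f = 0 := by
  induction m with
  | zero => exact h0
  | succ m ih =>
    refine ih (by omega) ?_
    have hlower := lower_raise_pow hf h m
    rw [h0, map_zero] at hlower
    have hcoeff : ((m : R) + 1) * (#s - 2 * a - m) = ((m + 1) * (#s - 2 * a - m) : ℕ) := by
      rw [Nat.cast_mul, Nat.cast_sub (by omega), Nat.cast_sub (by omega)]
      push_cast
      ring
    have hne : (m + 1) * (#s - 2 * a - m) ≠ 0 := Nat.mul_ne_zero (by omega) (by omega)
    rw [hcoeff] at hlower
    ext z
    exact (mul_eq_zero.1 (congrFun hlower z).symm).resolve_left (Nat.cast_ne_zero.2 hne)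

/-! ### Permutations -/

theorem relabel_adjoin (σ : Perm α) (w : Finset α) (f : Finset α → R) :
    relabel σ (adjoin w f) = adjoin (σ • w) (relabel σ f) := by
  ext z
  simp only [relabel_apply, adjoin_apply, smul_finset_sdiff, inv_smul_smul,
    subset_smul_finset_iff, inv_inv]

theorem commute_relabel_adjoin {σ : Perm α} {w : Finset α} (h : σ • w = w) :
    Commute (relabel σ : Module.End R (Finset α → R)) (adjoin w) :=
  LinearMap.ext fun f => by rw [Module.End.mul_apply, relabel_adjoin, h, Module.End.mul_apply]

theorem commute_relabel_raise {σ : Perm α} {s : Finset α} (h : σ • s = s) :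
    Commute (relabel σ : Module.End R (Finset α → R)) (raise s) := by
  refine LinearMap.ext fun f => ?_
  simp only [Module.End.mul_apply, raise, LinearMap.sum_apply, map_sum, relabel_adjoin,
    smul_finset_singleton]
  conv_rhs => rw [← h]
  exact (sum_image (f := fun x => adjoin {x} (relabel σ f)) σ.injective.injOn).symm

theorem mem_swap_smul {x y u : α} {s : Finset α} : u ∈ swap x y • s ↔ swap x y u ∈ s := by
  rw [← swap_inv, mem_inv_smul_finset_iff, swap_inv, Perm.smul_def]

theorem swap_smul_of_mem_iff {x y : α} {s : Finset α} (h : x ∈ s ↔ y ∈ s) : swap x y • s = s := by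
  ext u
  rw [mem_swap_smul, swap_apply_def]
  split_ifs with hx hy
  · rw [hx, h]
  · rw [hy, h]
  · rfl

theorem swap_smul_of_mem_of_notMem {x y : α} {s : Finset α} (hx : x ∈ s) (hy : y ∉ s) :
    swap x y • s = insert y (s \ {x}) := by
  ext u
  rw [mem_swap_smul, swap_apply_def]
  split_ifs with hux huy
  · subst hux
    simp [hy, ne_of_mem_of_not_mem hx hy]
  · simp [huy, hx]
  · simp [hux, huy]

theorem commute_swapSum_raise {s t : Finset α} (h : s ⊆ t) :
    Commute (swapSum s : Module.End R (Finset α → R)) (raise t) :=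
  Commute.sum_left _ _ _ fun _ hx => Commute.sum_left _ _ _ fun _ hy =>
    commute_relabel_raise (swap_smul_of_mem_iff (iff_of_true (h hx) (h hy)))

theorem commute_swapSum_adjoin {s w : Finset α} (h : Disjoint s w) :
    Commute (swapSum s : Module.End R (Finset α → R)) (adjoin w) :=
  Commute.sum_left _ _ _ fun _ hx => Commute.sum_left _ _ _ fun _ hy =>
    commute_relabel_adjoin
      (swap_smul_of_mem_iff (iff_of_false (disjoint_left.1 h hx) (disjoint_left.1 h hy)))

theorem relabel_swap_apply (x y : α) (f : Finset α → R) (z : Finset α) :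
    relabel (swap x y) f z = adjoin {x} (contract y f) z + adjoin {y} (contract x f) z +
      ((if x ∈ z then 1 else 0) * (if y ∈ z then 1 else 0) +
        (1 - if x ∈ z then 1 else 0) * (1 - if y ∈ z then 1 else 0) -
        if x = y then (2 * if x ∈ z then 1 else 0) else 0) * f z := by
  rw [relabel_apply, swap_inv]
  simp only [adjoin_apply, contract_apply, singleton_subset_iff, mem_sdiff, mem_singleton]
  by_cases hxy : x = y
  · subst hxy
    rw [swap_smul_of_mem_iff Iff.rfl]
    by_cases hx : x ∈ z
    · simp [hx]
      ring
    · simp [hx]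
  by_cases hx : x ∈ z <;> by_cases hy : y ∈ z
  · simp [hx, hy, hxy, Ne.symm hxy, swap_smul_of_mem_iff]
  · simp [hx, hy, hxy, swap_smul_of_mem_of_notMem]
  · simp [hx, hy, hxy, swap_comm x y, swap_smul_of_mem_of_notMem]
  · simp [hx, hy, hxy, swap_smul_of_mem_iff]

/-- The eigenvalue of the sum of all `(x y)`, over ordered pairs from a set with `j` elements, on
the irreducible representation of shape `(j - a, a)`. -/
def swapEigenvalue (R : Type*) [CommRing R] (j a : ℕ) : R :=
  (a : R) ^ 2 + ((j : R) - a) ^ 2 - 2 * a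

theorem swapSum_apply (s : Finset α) (f : Finset α → R) (z : Finset α) :
    swapSum s f z = 2 * raise s (lower s f) z + swapEigenvalue R #s #(s ∩ z) * f z := by
  have hcard : ∑ x ∈ s, (if x ∈ z then 1 else 0 : R) = #(s ∩ z) := by
    rw [sum_boole, filter_mem_eq_inter]
  have hcard' : ∑ x ∈ s, (1 - if x ∈ z then 1 else 0 : R) = #s - #(s ∩ z) := by
    rw [sum_sub_distrib, hcard, sum_const, nsmul_one]
  have hraise : ∑ x ∈ s, ∑ y ∈ s, adjoin {x} (contract y f) z = raise s (lower s f) z := by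
    rw [sum_comm]
    simp only [raise, lower, LinearMap.sum_apply, map_sum, Finset.sum_apply]
  have hraise' : ∑ x ∈ s, ∑ y ∈ s, adjoin {y} (contract x f) z = raise s (lower s f) z := by
    rw [← hraise, sum_comm]
  have hdiag : ∑ x ∈ s, ∑ y ∈ s, (if x = y then 2 * if x ∈ z then 1 else 0 else 0 : R) =
      2 * #(s ∩ z) := by
    rw [← hcard, mul_sum]
    exact sum_congr rfl fun x hx => by rw [sum_ite_eq, if_pos hx]
  simp only [swapSum, LinearMap.sum_apply, Finset.sum_apply, relabel_swap_apply, sum_add_distrib,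
    ← sum_mul, sum_sub_distrib, hraise, hraise', hdiag]
  rw [← sum_mul_sum, ← sum_mul_sum, hcard, hcard', swapEigenvalue]
  ring

theorem swapSum_eq_smul {s : Finset α} {a : ℕ} {f : Finset α → R} (hf : f ∈ sliceSpace R s a)
    (h : lower s f = 0) : swapSum s f = swapEigenvalue R #s a • f := by
  ext z
  rw [swapSum_apply, h, map_zero, Pi.zero_apply, mul_zero, zero_add, Pi.smul_apply, smul_eq_mul]
  by_cases hz : f z = 0
  · simp only [hz, mul_zero]
  · rw [inter_eq_right.2 (hf z hz).1, (hf z hz).2]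

theorem swapEigenvalue_injOn [NoZeroDivisors R] [CharZero R] {j a b : ℕ} (ha : 2 * a ≤ j)
    (hb : 2 * b ≤ j) (h : swapEigenvalue R j a = swapEigenvalue R j b) : a = b := by
  have hprod : (2 * ((b : R) - a)) * ((j - a - b + 1 : ℕ) : R) = 0 := by
    rw [Nat.cast_add_one, Nat.cast_sub (by omega), Nat.cast_sub (by omega)]
    unfold swapEigenvalue at h
    linear_combination h
  have hsub : (b : R) - a = 0 := by
    simpa [Nat.cast_add_one_ne_zero] using hprod
  exact_mod_cast (sub_eq_zero.1 hsub).symm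

end Operators

/-! ### Products of differences -/

section PairProducts

variable {α : Type*}

/-- All the elements that occur in the pairs of a list. -/
def vertices (l : List (α × α)) : List α := l.flatMap fun p => [p.1, p.2]

theorem vertices_cons (p : α × α) (l : List (α × α)) :
    vertices (p :: l) = p.1 :: p.2 :: vertices l := rfl

theorem length_vertices (l : List (α × α)) : (vertices l).length = 2 * l.length := by
  induction l with
  | nil => rfl
  | cons p l ih =>
    rw [vertices_cons, List.length_cons, List.length_cons, List.length_cons, ih]
    ring

variable {R : Type*} [DecidableEq α] [CommRing R]

theorem sliceSpace_mono {s t : Finset α} (h : s ⊆ t) (a : ℕ) :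
    sliceSpace R s a ≤ sliceSpace R t a :=
  fun _ hf z hz => ⟨(hf z hz).1.trans h, (hf z hz).2⟩

theorem contract_eq_zero {s : Finset α} {a : ℕ} {f : Finset α → R} (hf : f ∈ sliceSpace R s a)
    {x : α} (hx : x ∉ s) : contract x f = 0 := by
  ext z
  rw [contract_apply, Pi.zero_apply, ite_eq_left_iff]
  intro _
  by_contra h
  exact hx ((hf _ h).1 (mem_insert_self x z))

theorem contract_adjoin_of_mem_sliceSpace {s : Finset α} {a : ℕ} {f : Finset α → R}
    (hf : f ∈ sliceSpace R s a) {x : α} (hx : x ∉ s) : contract x (adjoin {x} f) = f := by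
  ext z
  rw [contract_adjoin_self, contract_eq_zero hf hx, map_zero, Pi.zero_apply, zero_add]
  by_cases hz : f z = 0
  · rw [hz, mul_zero]
  · rw [if_neg fun h => hx ((hf z hz).1 h), mul_zero, sub_zero, one_mul]

theorem lower_adjoin_singleton {s t : Finset α} {a : ℕ} {f : Finset α → R}
    (hf : f ∈ sliceSpace R t a) {x : α} (hs : x ∈ s) (ht : x ∉ t) :
    lower s (adjoin {x} f) = adjoin {x} (lower s f) + f := by
  have hlower : (lower s : Module.End R (Finset α → R)) = lower (s.erase x) + contract x :=
    (sum_erase_add _ _ hs).symm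
  have hcomm : lower (s.erase x) (adjoin {x} f) = adjoin {x} (lower (s.erase x) f) :=
    LinearMap.congr_fun (commute_lower_adjoin (disjoint_singleton_right.2 (notMem_erase x s))).eq f
  rw [hlower, LinearMap.add_apply, LinearMap.add_apply, hcomm, contract_eq_zero hf ht, add_zero,
    contract_adjoin_of_mem_sliceSpace hf ht]

theorem adjoin_adjoin_comm (x y : α) (f : Finset α → R) :
    adjoin {x} (adjoin {y} f) = adjoin {y} (adjoin {x} f) := by
  ext z
  simp only [adjoin_apply, singleton_subset_iff, mem_sdiff, mem_singleton, ← ite_and,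
    sdiff_right_comm z {x} {y}, eq_comm (a := x)]
  exact if_congr (by tauto) rfl rfl

theorem adjoin_adjoin_self (x : α) (f : Finset α → R) : adjoin {x} (adjoin {x} f) = 0 := by
  ext z
  simp [adjoin_apply]

variable (R) in
/-- The product `∏ (δ_x - δ_y)` over the pairs `(x, y)` of a list, where the product of delta
functions of disjoint sets is the delta function of the union. -/
def pairProduct : List (α × α) → Finset α → R
  | [] => Pi.single ∅ 1
  | p :: l => adjoin {p.1} (pairProduct l) - adjoin {p.2} (pairProduct l)

variable (R) in
/-- The span of the products `∏ (δ_x - δ_y)` of `a` differences, over `2 * a` distinct elements of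
`s`. For `2 * a ≤ #s` it is the Specht module of shape `(#s - a, a)`. -/
def pairSpan (s : Finset α) (a : ℕ) : Submodule R (Finset α → R) :=
  Submodule.span R (pairProduct R ''
    {l | l.length = a ∧ (vertices l).Nodup ∧ ∀ x ∈ vertices l, x ∈ s})

theorem relabel_pairProduct (σ : Perm α) (l : List (α × α)) :
    relabel σ (pairProduct R l) = pairProduct R (l.map (Prod.map σ σ)) := by
  induction l with
  | nil =>
    ext z
    simp only [relabel_apply, List.map_nil, pairProduct, Pi.single_apply, inv_smul_eq_iff,
      smul_finset_empty]
  | cons p l ih =>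
    rw [pairProduct, map_sub, relabel_adjoin, relabel_adjoin, smul_finset_singleton,
      smul_finset_singleton, ih]
    rfl

theorem pairProduct_mem_sliceSpace (l : List (α × α)) :
    pairProduct R l ∈ sliceSpace R (vertices l).toFinset l.length := by
  induction l with
  | nil =>
    intro z hz
    have : z = ∅ := by
      by_contra h
      exact hz (Pi.single_eq_of_ne h 1)
    simp [this]
  | cons p l ih =>
    rw [vertices_cons, List.toFinset_cons, List.toFinset_cons]
    refine sub_mem ?_ ?_ <;> refine sliceSpace_mono ?_ _ (adjoin_mem_sliceSpace ih)
    · grind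
    · grind

theorem lower_pairProduct {s : Finset α} {l : List (α × α)} (hl : (vertices l).Nodup)
    (hs : ∀ x ∈ vertices l, x ∈ s) : lower s (pairProduct R l) = 0 := by
  induction l with
  | nil =>
    rw [lower, LinearMap.sum_apply]
    exact sum_eq_zero fun x _ => contract_eq_zero (pairProduct_mem_sliceSpace []) List.not_mem_nil
  | cons p l ih =>
    simp only [vertices_cons, List.nodup_cons, List.mem_cons, forall_eq_or_imp, not_or] at hl hs
    rw [pairProduct, map_sub,
      lower_adjoin_singleton (pairProduct_mem_sliceSpace l) hs.1 (by simpa using hl.1.2),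
      lower_adjoin_singleton (pairProduct_mem_sliceSpace l) hs.2.1 (by simpa using hl.2.1),
      ih hl.2.2 hs.2.2]
    simp

theorem pairSpan_le_sliceSpace (s : Finset α) (a : ℕ) : pairSpan R s a ≤ sliceSpace R s a := by
  refine Submodule.span_le.2 ?_
  rintro _ ⟨l, ⟨rfl, -, hs⟩, rfl⟩
  refine sliceSpace_mono (fun x hx => hs x ?_) _ (pairProduct_mem_sliceSpace l)
  rwa [List.mem_toFinset] at hx

theorem lower_eq_zero_of_mem_pairSpan {s : Finset α} {a : ℕ} {f : Finset α → R}
    (hf : f ∈ pairSpan R s a) : lower s f = 0 := by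
  suffices pairSpan R s a ≤ LinearMap.ker (lower s) from this hf
  refine Submodule.span_le.2 ?_
  rintro _ ⟨l, ⟨-, hl, hs⟩, rfl⟩
  exact lower_pairProduct hl hs

theorem swapSum_of_mem_pairSpan {s : Finset α} {a : ℕ} {f : Finset α → R}
    (hf : f ∈ pairSpan R s a) : swapSum s f = swapEigenvalue R #s a • f :=
  swapSum_eq_smul (pairSpan_le_sliceSpace s a hf) (lower_eq_zero_of_mem_pairSpan hf)

theorem adjoin_pairProduct_add_adjoin {p : α × α} {l : List (α × α)} (hp : p ∈ l) :
    adjoin {p.1} (pairProduct R l) + adjoin {p.2} (pairProduct R l) = 0 := by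
  induction l with
  | nil => cases hp
  | cons q l ih =>
    rw [pairProduct, map_sub, map_sub]
    obtain rfl | hp := List.mem_cons.1 hp
    · rw [adjoin_adjoin_self, adjoin_adjoin_self, adjoin_adjoin_comm]
      abel
    · rw [adjoin_adjoin_comm p.1, adjoin_adjoin_comm p.1, adjoin_adjoin_comm p.2,
        adjoin_adjoin_comm p.2, sub_add_sub_comm, ← map_add, ← map_add, ih hp]
      simp

theorem sum_adjoin_vertices {l l' : List (α × α)} (h : ∀ p ∈ l', p ∈ l) :
    ((vertices l').map fun x => adjoin {x} (pairProduct R l)).sum = 0 := by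
  induction l' with
  | nil => rfl
  | cons p l' ih =>
    rw [List.forall_mem_cons] at h
    rw [vertices_cons, List.map_cons, List.map_cons, List.sum_cons, List.sum_cons, ih h.2, add_zero,
      adjoin_pairProduct_add_adjoin h.1]

theorem raise_pairProduct {s : Finset α} {l : List (α × α)} (hl : (vertices l).Nodup)
    (hs : (vertices l).toFinset ⊆ s) :
    raise s (pairProduct R l) = ∑ x ∈ s \ (vertices l).toFinset, adjoin {x} (pairProduct R l) := by
  rw [raise, LinearMap.sum_apply, ← sum_sdiff hs,
    List.sum_toFinset (fun x => adjoin {x} (pairProduct R l)) hl, sum_adjoin_vertices fun _ => id,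
    add_zero]

theorem raise_sub_adjoin_mem_pairSpan {s : Finset α} {a : ℕ} {f : Finset α → R}
    (hf : f ∈ pairSpan R s a) {i : α} (hi : i ∉ s) :
    raise s f - ((#s : R) - 2 * a) • adjoin {i} f ∈ pairSpan R (insert i s) (a + 1) := by
  suffices pairSpan R s a ≤ (pairSpan R (insert i s) (a + 1)).comap
    (raise s - ((#s : R) - 2 * a) • adjoin {i} : Module.End R (Finset α → R)) from this hf
  refine Submodule.span_le.2 ?_
  rintro _ ⟨l, ⟨rfl, hl, hs⟩, rfl⟩
  have hs' : (vertices l).toFinset ⊆ s := fun x hx => hs x (List.mem_toFinset.1 hx)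
  have hcard : (#s : R) - 2 * l.length = #(s \ (vertices l).toFinset) := by
    rw [← card_sdiff_add_card_eq_card hs', List.toFinset_card_of_nodup hl, length_vertices]
    push_cast
    ring
  change raise s (pairProduct R l) - ((#s : R) - 2 * l.length) • adjoin {i} (pairProduct R l) ∈
    pairSpan R (insert i s) (l.length + 1)
  rw [raise_pairProduct hl hs', hcard, Nat.cast_smul_eq_nsmul, ← sum_const, ← sum_sub_distrib]
  refine sum_mem fun x hx => Submodule.subset_span ⟨(x, i) :: l, ⟨rfl, ?_, ?_⟩, rfl⟩ <;>
    rw [mem_sdiff, List.mem_toFinset] at hx <;> rw [vertices_cons]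
  · have hxi : x ∉ i :: vertices l :=
      List.not_mem_cons_of_ne_of_not_mem (ne_of_mem_of_not_mem hx.1 hi) hx.2
    exact (hl.cons fun h => hi (hs i h)).cons hxi
  · simp only [List.mem_cons, mem_insert]
    rintro y (rfl | rfl | hy)
    exacts [.inr hx.1, .inl rfl, .inr (hs y hy)]

theorem pairSpan_mono {s t : Finset α} (h : s ⊆ t) (a : ℕ) : pairSpan R s a ≤ pairSpan R t a :=
  Submodule.span_mono (Set.image_mono fun _ hl => ⟨hl.1, hl.2.1, fun x hx => h (hl.2.2 x hx)⟩)

/-! ### Antisymmetric functions -/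

theorem relabel_contract (σ : Perm α) (x : α) (f : Finset α → R) :
    relabel σ (contract x f) = contract (σ x) (relabel σ f) := by
  ext z
  simp only [relabel_apply, contract_apply, mem_inv_smul_finset_iff, Perm.smul_def,
    smul_finset_insert, Perm.inv_def σ ▸ σ.symm_apply_apply x]

variable [NoZeroDivisors R] [CharZero R]

theorem eq_adjoin_contract_sub_of_relabel_swap {x y : α} {f : Finset α → R}
    (hxy : x ≠ y) (h : relabel (swap x y) f = -f) :
    f = adjoin {x} (contract x f) - adjoin {y} (contract x f) := by
  have hswap : ∀ z, f (swap x y • z) = - f z := fun z => by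
    rw [← Pi.neg_apply, ← h, relabel_apply, swap_inv]
  have hzero : ∀ z, (x ∈ z ↔ y ∈ z) → f z = 0 := fun z hz =>
    self_eq_neg.1 (by rw [← hswap, swap_smul_of_mem_iff hz])
  ext z
  simp only [Pi.sub_apply, adjoin_apply, contract_apply, singleton_subset_iff, mem_sdiff,
    mem_singleton]
  by_cases hx : x ∈ z <;> by_cases hy : y ∈ z
  · simp [hx, hy, hxy, hzero]
  · simp [hx, hy]
  · rw [← neg_inj, ← hswap, swap_comm, swap_smul_of_mem_of_notMem hy hx]
    simp [hx, hy, hxy]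
  · simp [hx, hy, hzero]

theorem eq_smul_pairProduct {l : List (α × α)} (hl : (vertices l).Nodup) {f : Finset α → R}
    (hcard : ∀ z, f z ≠ 0 → #z = l.length) (h : ∀ p ∈ l, relabel (swap p.1 p.2) f = -f) :
    f = f (l.map Prod.fst).toFinset • pairProduct R l := by
  induction l generalizing f with
  | nil =>
    ext z
    by_cases hz : z = ∅
    · simp [hz, pairProduct]
    · have : f z = 0 := not_imp_comm.1 (hcard z) (by simpa using hz)
      simp [hz, this, pairProduct]
  | cons p l ih =>
    obtain ⟨x, y⟩ := p
    simp only [vertices_cons, List.nodup_cons, List.mem_cons, not_or] at hl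
    have hx : x ∉ (l.map Prod.fst).toFinset := fun hx => hl.1.2 <| by
      simp only [List.mem_toFinset, List.mem_map] at hx
      obtain ⟨q, hq, rfl⟩ := hx
      exact List.mem_flatMap.2 ⟨q, hq, by simp⟩
    have hcontract : contract x f =
        f (insert x (l.map Prod.fst).toFinset) • pairProduct R l := by
      have happly : contract x f (l.map Prod.fst).toFinset =
          f (insert x (l.map Prod.fst).toFinset) := if_neg hx
      rw [← happly]
      refine ih hl.2.2 (fun z hz => ?_) fun q hq => ?_
      · rw [contract_apply, ite_ne_left_iff] at hz
        simpa [hz.1] using hcard _ hz.2.symm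
      · have hq1 : q.1 ∈ vertices l := List.mem_flatMap.2 ⟨q, hq, by simp⟩
        have hq2 : q.2 ∈ vertices l := List.mem_flatMap.2 ⟨q, hq, by simp⟩
        rw [relabel_contract, swap_apply_of_ne_of_ne (ne_of_mem_of_not_mem hq1 hl.1.2).symm
          (ne_of_mem_of_not_mem hq2 hl.1.2).symm, h q (List.mem_cons_of_mem _ hq), map_neg]
    have hsplit := eq_adjoin_contract_sub_of_relabel_swap hl.1.1 (h _ List.mem_cons_self)
    rw [hcontract, map_smul, map_smul, ← smul_sub] at hsplit
    simpa [pairProduct] using hsplit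

end PairProducts

/-! ### Gelfand-Tsetlin vectors -/

section GelfandTsetlin

variable {R : Type*} [CommRing R]

variable (R) in
/-- The Gelfand-Tsetlin vector of the standard tableau with `i` boxes whose second row consists of
the elements of `t` that are less than `i`. -/
def gtVec (t : Finset ℕ) : ℕ → Finset ℕ → R
  | 0 => Pi.single ∅ 1
  | i + 1 => if i ∈ t then
      raise (range i) (gtVec t i) - ((i : R) - 2 * Nat.count (· ∈ t) i) • adjoin {i} (gtVec t i)
    else gtVec t i

theorem gtVec_mem_pairSpan (t : Finset ℕ) (i : ℕ) :
    gtVec R t i ∈ pairSpan R (range i) (Nat.count (· ∈ t) i) := by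
  induction i with
  | zero => exact Submodule.subset_span ⟨[], ⟨rfl, List.nodup_nil, by simp [vertices]⟩, rfl⟩
  | succ i ih =>
    rw [gtVec, Nat.count_succ, range_add_one]
    split_ifs with hi
    · have := raise_sub_adjoin_mem_pairSpan ih (notMem_range_self (n := i))
      rwa [card_range] at this
    · exact pairSpan_mono (subset_insert _ _) _ ih

theorem swapSum_gtVec (t : Finset ℕ) {i j : ℕ} (h : j ≤ i) :
    swapSum (range j) (gtVec R t i) =
      swapEigenvalue R j (Nat.count (· ∈ t) j) • gtVec R t i := by
  induction i, h using Nat.le_induction with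
  | base =>
    have := swapSum_of_mem_pairSpan (gtVec_mem_pairSpan (R := R) t j)
    rwa [card_range] at this
  | succ i hi ih =>
    have hraise : swapSum (range j) (raise (range i) (gtVec R t i)) =
        raise (range i) (swapSum (range j) (gtVec R t i)) :=
      LinearMap.congr_fun (commute_swapSum_raise (range_subset_range.2 hi)).eq _
    have hadjoin : swapSum (range j) (adjoin {i} (gtVec R t i)) =
        adjoin {i} (swapSum (range j) (gtVec R t i)) :=
      LinearMap.congr_fun (commute_swapSum_adjoin (by simpa using hi)).eq _
    rw [gtVec]
    split_ifs with hit
    · rw [map_sub, map_smul, hraise, hadjoin, ih, map_smul, map_smul, smul_comm, ← smul_sub]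
    · exact ih

theorem gtVec_ne_zero [NoZeroDivisors R] [CharZero R] {t : Finset ℕ} {i : ℕ}
    (h : ∀ j ≤ i, 2 * Nat.count (· ∈ t) j ≤ j) : gtVec R t i ≠ 0 := by
  induction i with
  | zero => exact fun h0 => one_ne_zero (α := R) (by simpa [gtVec] using congrFun h0 ∅)
  | succ i ih =>
    have hne := ih fun j hj => h j (hj.trans i.le_succ)
    rw [gtVec]
    split_ifs with hi
    · intro h0
      have hslice := pairSpan_le_sliceSpace _ _ (gtVec_mem_pairSpan (R := R) t i)
      have hcount := h (i + 1) le_rfl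
      rw [Nat.count_succ, if_pos hi] at hcount
      have hcoeff : (i : R) - 2 * Nat.count (· ∈ t) i = (i - 2 * Nat.count (· ∈ t) i : ℕ) := by
        rw [Nat.cast_sub (by omega)]
        push_cast
        rfl
      have hraise : contract i (raise (range i) (gtVec R t i)) = 0 :=
        contract_eq_zero (raise_mem_sliceSpace hslice) notMem_range_self
      have hcontract := congrArg (contract i) h0
      rw [map_sub, map_smul, hraise, contract_adjoin_of_mem_sliceSpace hslice notMem_range_self,
        zero_sub, map_zero, neg_eq_zero, hcoeff] at hcontract
      refine hne (funext fun z => (mul_eq_zero.1 (congrFun hcontract z)).resolve_left ?_)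
      exact Nat.cast_ne_zero.2 (by omega)
    · exact hne

end GelfandTsetlin

/-! ### Restriction to a slice and extension by zero -/

/-- A permutation of the first `m` natural numbers as a permutation of `ℕ`. -/
def permNat {m : ℕ} (σ : Perm (Fin m)) : Perm ℕ := σ.viaEmbedding Fin.valEmbedding

/-- A `k`-subset of `Fin n` as a set of natural numbers. -/
def natSet {n k : ℕ} (x : KSet n k) : Finset ℕ := (x : Finset (Fin n)).map Fin.valEmbedding

/-- The restriction to the `k`-subsets of the first `n` natural numbers. -/
def restrict (n k : ℕ) : (Finset ℕ → ℂ) →ₗ[ℂ] FunSpace n k :=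
  (WithLp.linearEquiv 2 ℂ (KSet n k → ℂ)).symm.toLinearMap ∘ₗ LinearMap.funLeft ℂ ℂ natSet

/-- The extension by zero to all finite sets of natural numbers. -/
def extend (n k : ℕ) : FunSpace n k →ₗ[ℂ] (Finset ℕ → ℂ) :=
  Function.ExtendByZero.linearMap ℂ natSet ∘ₗ (WithLp.linearEquiv 2 ℂ (KSet n k → ℂ)).toLinearMap

section Restriction

variable {n k m : ℕ}

theorem permNat_inv (σ : Perm (Fin m)) : permNat σ⁻¹ = (permNat σ)⁻¹ :=
  map_inv (Perm.viaEmbeddingHom Fin.valEmbedding) σ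

theorem permNat_val (σ : Perm (Fin m)) (x : Fin m) : permNat σ x = σ x :=
  σ.viaEmbedding_apply Fin.valEmbedding x

theorem permNat_of_le (σ : Perm (Fin m)) {x : ℕ} (hx : m ≤ x) : permNat σ x = x := by
  refine σ.viaEmbedding_apply_of_notMem Fin.valEmbedding x ?_
  rintro ⟨y, rfl⟩
  exact y.isLt.not_ge hx

theorem permNat_swap (x y : Fin m) : permNat (swap x y) = swap (x : ℕ) (y : ℕ) := by
  ext u
  rcases lt_or_ge u m with h | h
  · lift u to Fin m using h
    rw [permNat_val, Fin.val_injective.swap_apply]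
  · rw [permNat_of_le _ h, swap_apply_of_ne_of_ne] <;> omega

theorem permNat_viaEmbedding (h : m ≤ n) (σ : Perm (Fin m)) :
    permNat (σ.viaEmbedding (Fin.castLEEmb h)) = permNat σ := by
  ext u
  rcases lt_or_ge u m with hu | hu
  · lift u to Fin m using hu
    have := permNat_val (σ.viaEmbedding (Fin.castLEEmb h)) (Fin.castLEEmb h u)
    rw [Perm.viaEmbedding_apply] at this
    rw [permNat_val]
    exact this
  rw [permNat_of_le σ hu]
  rcases lt_or_ge u n with hu' | hu'
  · lift u to Fin n using hu'
    rw [permNat_val, Perm.viaEmbedding_apply_of_notMem]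
    rintro ⟨y, rfl⟩
    exact y.isLt.not_ge hu
  · exact permNat_of_le _ hu'

theorem permNat_smul_of_le (σ : Perm (Fin m)) {w : Finset ℕ} (h : ∀ x ∈ w, m ≤ x) :
    permNat σ • w = w := by
  have hfix : Set.EqOn (permNat σ) id w := fun x hx => permNat_of_le σ (h x hx)
  rw [← Finset.coe_inj, coe_smul_finset]
  exact (Set.image_congr hfix).trans (Set.image_id _)

theorem permNat_smul_range (σ : Perm (Fin m)) : permNat σ • range m = range m := by
  refine eq_of_subset_of_card_le ?_ (card_smul_finset _ _).ge
  intro _ h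
  obtain ⟨x, hx, rfl⟩ := mem_smul_finset.1 h
  lift x to Fin m using mem_range.1 hx
  rw [Perm.smul_def, permNat_val]
  exact mem_range.2 (σ x).isLt

theorem natSet_injective : Function.Injective (natSet : KSet n k → Finset ℕ) :=
  (map_injective _).comp Subtype.val_injective

theorem natSet_subset (x : KSet n k) : natSet x ⊆ range n := fun _ h => by
  obtain ⟨y, -, rfl⟩ := mem_map.1 h
  exact mem_range.2 y.isLt

theorem card_kset (n k : ℕ) : Fintype.card (KSet n k) = n.choose k := by
  rw [← Nat.card_eq_fintype_card, Set.powersetCard.card, Nat.card_fin]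

theorem card_natSet (x : KSet n k) : #(natSet x) = k := by
  rw [natSet, card_map, Set.powersetCard.card_eq]

theorem exists_natSet_eq {z : Finset ℕ} (h : z ⊆ range n) (hz : #z = k) :
    ∃ x : KSet n k, natSet x = z := by
  have hmap : (z.attachFin fun x hx => mem_range.1 (h hx)).map Fin.valEmbedding = z :=
    map_valEmbedding_attachFin _
  exact ⟨⟨_, Set.powersetCard.mem_iff.2 ((card_attachFin _ _).trans hz)⟩, hmap⟩

theorem natSet_smul (σ : Perm (Fin n)) (x : KSet n k) : natSet (σ • x) = permNat σ • natSet x := by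
  rw [natSet, natSet, Set.powersetCard.coe_smul, ← Finset.coe_inj, coe_smul_finset, coe_map,
    coe_map, coe_smul_finset]
  exact Set.image_comm fun y => (permNat_val σ y).symm

theorem restrict_apply (f : Finset ℕ → ℂ) (x : KSet n k) : restrict n k f x = f (natSet x) := rfl

theorem extend_natSet (h : FunSpace n k) (x : KSet n k) : extend n k h (natSet x) = h x :=
  natSet_injective.extend_apply _ _ _

theorem restrict_extend (h : FunSpace n k) : restrict n k (extend n k h) = h := by
  ext x
  rw [restrict_apply, extend_natSet]

theorem extend_mem_sliceSpace (h : FunSpace n k) : extend n k h ∈ sliceSpace ℂ (range n) k := by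
  intro z hz
  by_contra hz'
  refine hz (Function.extend_apply' _ _ _ ?_)
  rintro ⟨x, rfl⟩
  exact hz' ⟨natSet_subset x, card_natSet x⟩

theorem extend_restrict {f : Finset ℕ → ℂ} (hf : f ∈ sliceSpace ℂ (range n) k) :
    extend n k (restrict n k f) = f := by
  ext z
  by_cases hz : z ⊆ range n ∧ #z = k
  · obtain ⟨x, rfl⟩ := exists_natSet_eq hz.1 hz.2
    rw [extend_natSet, restrict_apply]
  · rw [not_imp_comm.1 (hf z) hz, not_imp_comm.1 (extend_mem_sliceSpace _ z) hz]

theorem permRep_restrict (σ : Perm (Fin n)) (f : Finset ℕ → ℂ) :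
    permRep n k σ (restrict n k f) = restrict n k (relabel (permNat σ) f) := by
  ext x
  rw [restrict_apply, relabel_apply, ← permNat_inv, ← natSet_smul]
  rfl

theorem stageRep_restrict (h : m ≤ n) (σ : Perm (Fin m)) (f : Finset ℕ → ℂ) :
    stageRep n k m h σ (restrict n k f) = restrict n k (relabel (permNat σ) f) := by
  rw [← permNat_viaEmbedding h, ← permRep_restrict]
  rfl

theorem extend_permRep (σ : Perm (Fin n)) (h : FunSpace n k) :
    extend n k (permRep n k σ h) = relabel (permNat σ) (extend n k h) := by
  have hmem : relabel (permNat σ) (extend n k h) ∈ sliceSpace ℂ (range n) k := by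
    intro z hz
    have := extend_mem_sliceSpace h _ hz
    rwa [card_smul_finset, ← smul_finset_subset_smul_finset_iff (a := permNat σ), smul_inv_smul,
      permNat_smul_range] at this
  rw [← extend_restrict hmem, ← permRep_restrict, restrict_extend]

end Restriction

/-! ### Specht modules -/

/-- The columns with two entries of the tableau whose first row is `0, …, m - a - 1`; the entry of
the second row comes first. -/
def columnPairs (m a : ℕ) : List (ℕ × ℕ) := (List.range a).map fun l => (m - a + l, l)

section Specht

variable {m a : ℕ}

theorem length_columnPairs (m a : ℕ) : (columnPairs m a).length = a := by
  rw [columnPairs, List.length_map, List.length_range]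

theorem nodup_vertices_columnPairs (h : 2 * a ≤ m) : (vertices (columnPairs m a)).Nodup := by
  rw [vertices, List.nodup_flatMap, columnPairs, List.pairwise_map]
  refine ⟨?_, List.nodup_range.imp_of_mem fun {l l'} hl hl' hne => ?_⟩
  · rintro _ hp
    obtain ⟨l, hl, rfl⟩ := List.mem_map.1 hp
    have := List.mem_range.1 hl
    simp only [List.nodup_cons, List.mem_singleton, List.not_mem_nil, not_false_eq_true,
      List.nodup_nil, and_self, and_true]
    omega
  · have := List.mem_range.1 hl
    have := List.mem_range.1 hl'
    simp only [Function.onFun, List.disjoint_left, List.mem_cons, List.not_mem_nil, or_false]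
    omega

theorem lt_of_mem_vertices_columnPairs (h : 2 * a ≤ m) {x : ℕ}
    (hx : x ∈ vertices (columnPairs m a)) : x < m := by
  obtain ⟨p, hp, hx⟩ := List.mem_flatMap.1 hx
  obtain ⟨l, hl, rfl⟩ := List.mem_map.1 hp
  have := List.mem_range.1 hl
  simp only [List.mem_cons, List.not_mem_nil, or_false] at hx
  omega

theorem mem_columnGroup {π : Perm (Fin m)} :
    π ∈ columnGroup m a ↔ ∀ x, column m a (π x) = column m a x := by
  rw [columnGroup, mem_filter_univ]

theorem permRep_polytabloid {π : Perm (Fin m)} (hπ : π ∈ columnGroup m a) :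
    permRep m a π (polytabloid m a) = ((Perm.sign π : ℤ) : ℂ) • polytabloid m a := by
  have hmem : ∀ τ, π * τ ∈ columnGroup m a ↔ τ ∈ columnGroup m a := fun τ => by
    simp only [mem_columnGroup, Perm.mul_apply, mem_columnGroup.1 hπ]
  ext x
  change ∑ τ ∈ columnGroup m a, (if (π⁻¹ • x : KSet m a) = τ • secondRow m a then
    ((Perm.sign τ : ℤ) : ℂ) else 0) = ((Perm.sign π : ℤ) : ℂ) * ∑ τ ∈ columnGroup m a,
      if (x : Finset (Fin m)) = τ • secondRow m a then ((Perm.sign τ : ℤ) : ℂ) else 0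
  rw [mul_sum]
  refine sum_equiv (Equiv.mulLeft π) (fun τ => (hmem τ).symm) fun τ _ => ?_
  have hsign : ((Perm.sign π : ℤ) : ℂ) * ((Perm.sign (π * τ) : ℤ) : ℂ) = (Perm.sign τ : ℤ) := by
    rw [Perm.sign_mul, ← Int.cast_mul, ← Units.val_mul, ← mul_assoc, Int.units_mul_self, one_mul]
  simp only [Set.powersetCard.coe_smul, inv_smul_eq_iff, coe_mulLeft, mul_smul, mul_ite, mul_zero,
    hsign]

theorem card_secondRow (h : a ≤ m) : #(secondRow m a) = a := by
  have hmap : (secondRow m a).map Fin.valEmbedding = Ico (m - a) m := by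
    ext x
    simp only [secondRow, mem_map, mem_filter_univ, Fin.valEmbedding_apply, mem_Ico]
    exact ⟨by rintro ⟨y, hy, rfl⟩; exact ⟨hy, y.isLt⟩, fun hx => ⟨⟨x, hx.2⟩, hx.1, rfl⟩⟩
  rw [← card_map Fin.valEmbedding, hmap, Nat.card_Ico]
  omega

theorem eq_one_of_smul_secondRow {π : Perm (Fin m)} (hπ : π ∈ columnGroup m a)
    (h : π • secondRow m a = secondRow m a) : π = 1 := by
  ext x
  have hcol := mem_columnGroup.1 hπ x
  have hrow : m - a ≤ (π x : ℕ) ↔ m - a ≤ (x : ℕ) := by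
    have hmem : π x ∈ secondRow m a ↔ x ∈ secondRow m a := by
      conv_lhs => rw [← h, ← Perm.smul_def, smul_mem_smul_finset_iff]
    simpa only [secondRow, mem_filter_univ] using hmem
  simp only [column] at hcol
  rw [Perm.one_apply]
  split_ifs at hcol <;> omega

theorem polytabloid_secondRow {x : KSet m a} (hx : (x : Finset (Fin m)) = secondRow m a) :
    polytabloid m a x = 1 := by
  change ∑ π ∈ columnGroup m a, (if (x : Finset (Fin m)) = π • secondRow m a then
    ((Perm.sign π : ℤ) : ℂ) else 0) = 1
  rw [sum_eq_single 1, one_smul, if_pos hx, Perm.sign_one, Units.val_one, Int.cast_one]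
  · exact fun π hπ hne => if_neg fun h =>
      hne (eq_one_of_smul_secondRow hπ (h.symm.trans hx))
  · exact fun h => (h (mem_columnGroup.2 fun _ => rfl)).elim

theorem relabel_swap_extend_polytabloid (h : 2 * a ≤ m) {p : ℕ × ℕ} (hp : p ∈ columnPairs m a) :
    relabel (swap p.1 p.2) (extend m a (polytabloid m a)) = -extend m a (polytabloid m a) := by
  obtain ⟨l, hl, rfl⟩ := List.mem_map.1 hp
  have hl := List.mem_range.1 hl
  let y : Fin m := ⟨m - a + l, by omega⟩
  let y' : Fin m := ⟨l, by omega⟩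
  have hne : y ≠ y' := fun h' => by
    have : m - a + l = l := congrArg Fin.val h'
    omega
  have hcol : column m a y = column m a y' := by
    simp only [column, y, y']
    split_ifs <;> omega
  have hmem : swap y y' ∈ columnGroup m a := mem_columnGroup.2 fun u => by
    rw [swap_apply_def]
    split_ifs with hu hu'
    · rw [hu, hcol]
    · rw [hu', hcol]
    · rfl
  have := permRep_polytabloid hmem
  rw [Perm.sign_swap hne] at this
  change relabel (swap (y : ℕ) (y' : ℕ)) _ = _
  rw [← permNat_swap, ← extend_permRep, this, map_smul, Units.val_neg, Units.val_one,
    Int.cast_neg, Int.cast_one, neg_one_smul]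

theorem extend_polytabloid (h : 2 * a ≤ m) :
    extend m a (polytabloid m a) = pairProduct ℂ (columnPairs m a) := by
  obtain ⟨x, hx⟩ : ∃ x : KSet m a, (x : Finset (Fin m)) = secondRow m a :=
    ⟨⟨_, Set.powersetCard.mem_iff.2 (card_secondRow (by omega))⟩, rfl⟩
  have hfirst : ((columnPairs m a).map Prod.fst).toFinset = natSet x := by
    ext y
    simp only [columnPairs, natSet, hx, secondRow, List.map_map, List.mem_toFinset, List.mem_map,
      List.mem_range, Function.comp_apply, mem_map, mem_filter_univ, Fin.valEmbedding_apply]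
    constructor
    · rintro ⟨l, hl, rfl⟩
      exact ⟨⟨m - a + l, by omega⟩, by simp, rfl⟩
    · rintro ⟨y, hy, rfl⟩
      exact ⟨y - (m - a), by omega, by omega⟩
  rw [eq_smul_pairProduct (nodup_vertices_columnPairs h) (fun z hz => ?_) fun _ =>
    relabel_swap_extend_polytabloid h, hfirst, extend_natSet, polytabloid_secondRow hx, one_smul]
  rw [(extend_mem_sliceSpace _ z hz).2, length_columnPairs]

theorem vertices_injective {α : Type*} :
    Function.Injective (vertices : List (α × α) → List α) := by
  intro l
  induction l with
  | nil =>
    rintro (_ | ⟨p, l'⟩) h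
    · rfl
    · cases h
  | cons p l ih =>
    rintro (_ | ⟨p', l'⟩) h
    · cases h
    · obtain ⟨h₁, h₂, h₃⟩ : p.1 = p'.1 ∧ p.2 = p'.2 ∧ vertices l = vertices l' := by
        simpa only [vertices_cons, List.cons.injEq] using h
      rw [Prod.ext h₁ h₂, ih h₃]

theorem vertices_map {α β : Type*} (g : α → β) (l : List (α × α)) :
    vertices (l.map (Prod.map g g)) = (vertices l).map g := by
  rw [vertices, vertices, List.flatMap_map, List.map_flatMap]
  rfl

theorem exists_map_permNat_eq {l l' : List ℕ} (hl : l.Nodup) (hl' : l'.Nodup)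
    (hlt : ∀ x ∈ l, x < m) (hlt' : ∀ x ∈ l', x < m) (hlen : l.length = l'.length) :
    ∃ σ : Perm (Fin m), l.map (permNat σ) = l' := by
  have hpre := Equiv.Perm.isMultiplyPretransitive (Fin m) l.length
  rw [MulAction.isMultiplyPretransitive_iff] at hpre
  obtain ⟨σ, hσ⟩ := hpre
    ⟨fun i => ⟨l.get i, hlt _ (l.get_mem i)⟩, fun i j h =>
      List.nodup_iff_injective_get.1 hl (Fin.mk.inj h)⟩
    ⟨fun i => ⟨l'.get (i.cast hlen), hlt' _ (l'.get_mem _)⟩, fun i j h =>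
      Fin.cast_injective hlen (List.nodup_iff_injective_get.1 hl' (Fin.mk.inj h))⟩
  refine ⟨σ, List.ext_get (by rw [List.length_map, hlen]) fun i h h' => ?_⟩
  rw [List.length_map] at h
  have := congrArg Fin.val (DFunLike.congr_fun hσ ⟨i, h⟩)
  simp only [List.get_eq_getElem, List.getElem_map]
  exact (permNat_val σ ⟨l[i], hlt _ (l.getElem_mem h)⟩).trans this

theorem map_extend_specht (h : 2 * a ≤ m) :
    (specht m a).toSubmodule.map (extend m a) = pairSpan ℂ (range m) a := by
  change Submodule.map _ (Submodule.span ℂ _) = _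
  rw [Submodule.map_span, ← Set.range_comp, pairSpan]
  congr 1
  have hrel : ∀ σ : Perm (Fin m), extend m a (permRep m a σ (polytabloid m a)) =
      pairProduct ℂ ((columnPairs m a).map (Prod.map (permNat σ) (permNat σ))) := fun σ => by
    rw [extend_permRep, extend_polytabloid h, relabel_pairProduct]
  ext f
  simp only [Set.mem_range, Function.comp_apply, Set.mem_image, Set.mem_ofPred_eq, hrel]
  constructor
  · rintro ⟨σ, rfl⟩
    refine ⟨_, ⟨?_, ?_, ?_⟩, rfl⟩
    · rw [List.length_map, length_columnPairs]
    · rw [vertices_map]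
      exact (nodup_vertices_columnPairs h).map (permNat σ).injective
    · intro x hx
      rw [vertices_map] at hx
      obtain ⟨y, hy, rfl⟩ := List.mem_map.1 hx
      rw [← permNat_smul_range σ]
      exact smul_mem_smul_finset (mem_range.2 (lt_of_mem_vertices_columnPairs h hy))
  · rintro ⟨l, ⟨hlen, hl, hlt⟩, rfl⟩
    obtain ⟨σ, hσ⟩ := exists_map_permNat_eq (nodup_vertices_columnPairs h) hl
      (fun x hx => lt_of_mem_vertices_columnPairs h hx) (fun x hx => mem_range.1 (hlt x hx))
      (by rw [length_vertices, length_vertices, length_columnPairs, hlen])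
    exact ⟨σ, congrArg _ (vertices_injective ((vertices_map _ _).trans hσ))⟩

end Specht

/-! ### Isotypic components -/

section RepSwapSum

variable {α R V W : Type*} [Fintype α] [DecidableEq α] [CommRing R] [AddCommGroup V] [Module R V]
  [AddCommGroup W] [Module R W]

/-- The sum of `(x y)` over all ordered pairs, including `x = y`, in a representation of a symmetric
group. -/
def repSwapSum (ρ : Representation R (Perm α) V) : Module.End R V := ∑ x, ∑ y, ρ (swap x y)

theorem repSwapSum_apply (ρ : Representation R (Perm α) V) (v : V) :
    repSwapSum ρ v = ∑ x, ∑ y, ρ (swap x y) v := by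
  simp only [repSwapSum, LinearMap.sum_apply]

theorem repSwapSum_intertwiningMap {ρ : Representation R (Perm α) V}
    {ρ' : Representation R (Perm α) W} (φ : ρ.IntertwiningMap ρ') (v : V) :
    repSwapSum ρ' (φ v) = φ (repSwapSum ρ v) := by
  simp only [repSwapSum_apply, map_sum, φ.isIntertwining]

end RepSwapSum

theorem isSymmetric_repSwapSum {α E : Type*} [Fintype α] [DecidableEq α] [NormedAddCommGroup E]
    [InnerProductSpace ℂ E] {ρ : Representation ℂ (Perm α) E}
    (h : ∀ σ v w, inner ℂ (ρ σ v) (ρ σ w) = inner ℂ v w) : (repSwapSum ρ).IsSymmetric := by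
  intro v w
  simp only [repSwapSum_apply, sum_inner, inner_sum]
  refine sum_congr rfl fun x _ => sum_congr rfl fun y _ => ?_
  have hinv : ρ (swap x y) (ρ (swap x y) w) = w := by
    rw [← Module.End.mul_apply, ← map_mul, swap_mul_self, map_one, Module.End.one_apply]
  rw [← h (swap x y) v, hinv]

/-- The eigenspace of the sum of all `(x y)` in `S_i`, over ordered pairs, for its eigenvalue on the
irreducible representation of shape `(i - a, a)`. For `2 * a ≤ i` it is the isotypic component of
that shape. -/
def stageEigenspace (n k i : ℕ) (hi : i ≤ n) (a : ℕ) : Submodule ℂ (FunSpace n k) :=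
  Module.End.eigenspace (repSwapSum (stageRep n k i hi)) (swapEigenvalue ℂ i a)

section Isotypic

variable {n k i a b m : ℕ} (hi : i ≤ n)

theorem inner_permRep (σ : Perm (Fin n)) (f g : FunSpace n k) :
    inner ℂ (permRep n k σ f) (permRep n k σ g) = inner ℂ f g := by
  rw [PiLp.inner_apply, PiLp.inner_apply]
  exact Equiv.sum_comp (MulAction.toPerm σ⁻¹) fun x => inner ℂ (f x) (g x)

theorem stageEigenspace_isOrtho (ha : 2 * a ≤ i) (hb : 2 * b ≤ i) (hab : a ≠ b) :
    stageEigenspace n k i hi a ⟂ stageEigenspace n k i hi b := by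
  have hsymm : (repSwapSum (stageRep n k i hi)).IsSymmetric :=
    isSymmetric_repSwapSum fun _ => inner_permRep _
  exact hsymm.orthogonalFamily_eigenspaces.isOrtho
    fun h => hab (swapEigenvalue_injOn ha hb h)

theorem swapSum_range (f : Finset ℕ → ℂ) :
    swapSum (range m) f = ∑ x : Fin m, ∑ y : Fin m, relabel (permNat (swap x y)) f := by
  simp only [swapSum, LinearMap.sum_apply, sum_range, permNat_swap]

theorem repSwapSum_stageRep_restrict (f : Finset ℕ → ℂ) :
    repSwapSum (stageRep n k i hi) (restrict n k f) = restrict n k (swapSum (range i) f) := by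
  simp only [repSwapSum_apply, swapSum_range, map_sum, stageRep_restrict]

theorem extend_repSwapSum_permRep (h : FunSpace m a) :
    extend m a (repSwapSum (permRep m a) h) = swapSum (range m) (extend m a h) := by
  simp only [repSwapSum_apply, swapSum_range, map_sum, extend_permRep]

theorem extend_mem_pairSpan (ha : 2 * a ≤ i) {h : FunSpace i a}
    (hh : h ∈ (specht i a).toSubmodule) : extend i a h ∈ pairSpan ℂ (range i) a := by
  rw [← map_extend_specht ha]
  exact Submodule.mem_map_of_mem hh

theorem repSwapSum_permRep_of_mem_specht (ha : 2 * a ≤ i) {h : FunSpace i a}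
    (hh : h ∈ (specht i a).toSubmodule) :
    repSwapSum (permRep i a) h = swapEigenvalue ℂ i a • h := by
  rw [← restrict_extend (repSwapSum _ h), extend_repSwapSum_permRep,
    swapSum_of_mem_pairSpan (extend_mem_pairSpan ha hh), card_range, map_smul, restrict_extend]

theorem isotypic_le_stageEigenspace (ha : 2 * a ≤ i) :
    isotypic n k i hi a ≤ stageEigenspace n k i hi a := by
  refine iSup_le fun φ => iSup_le fun _ => ?_
  rintro _ ⟨v, rfl⟩
  have hv : repSwapSum (specht i a).toRepresentation v = swapEigenvalue ℂ i a • v := by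
    refine Subtype.ext (Eq.trans ?_ (repSwapSum_permRep_of_mem_specht ha v.2))
    simp only [repSwapSum_apply, Submodule.coe_sum]
    rfl
  rw [stageEigenspace, Module.End.mem_eigenspace_iff,
    Representation.IntertwiningMap.toLinearMap_apply,
    repSwapSum_intertwiningMap, hv, map_smul]

theorem eq_zero_of_restrict_adjoin_raise_pow_eq_zero (hi : i ≤ n) (hm : 2 * a + m ≤ i)
    {w : Finset ℕ} (hw : w ⊆ Ico i n) (hk : a + m + #w = k) {f : Finset ℕ → ℂ}
    (hf : f ∈ pairSpan ℂ (range i) a)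
    (h : restrict n k (adjoin w ((raise (range i) ^ m) f)) = 0) : f = 0 := by
  have hslice := pairSpan_le_sliceSpace _ _ hf
  have hraise := raise_pow_mem_sliceSpace hslice m
  have hdisj : Disjoint (range i) w := disjoint_left.2 fun x hx hxw =>
    (mem_Ico.1 (hw hxw)).1.not_gt (mem_range.1 hx)
  have hsub : range i ∪ w ⊆ range n := union_subset (range_subset_range.2 hi) fun x hx =>
    mem_range.2 (mem_Ico.1 (hw hx)).2
  have hadjoin := sliceSpace_mono hsub _ (adjoin_mem_sliceSpace (w := w) hraise)
  rw [hk] at hadjoin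
  refine eq_zero_of_raise_pow_eq_zero hslice (lower_eq_zero_of_mem_pairSpan hf)
    (by rwa [card_range]) (eq_zero_of_adjoin_eq_zero hdisj hraise ?_)
  rw [← extend_restrict hadjoin, h, map_zero]

theorem restrict_adjoin_raise_pow_mem_isotypic (hm : 2 * a + m ≤ i) {w : Finset ℕ}
    (hw : w ⊆ Ico i n) (hk : a + m + #w = k) {f : Finset ℕ → ℂ}
    (hf : f ∈ pairSpan ℂ (range i) a) :
    restrict n k (adjoin w ((raise (range i) ^ m) f)) ∈ isotypic n k i hi a := by
  have ha : 2 * a ≤ i := by omega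
  let ψ : FunSpace i a →ₗ[ℂ] FunSpace n k :=
    restrict n k ∘ₗ adjoin w ∘ₗ (raise (range i) ^ m) ∘ₗ extend i a
  have hψ : ∀ (σ : Perm (Fin i)) (h : FunSpace i a),
      ψ (permRep i a σ h) = stageRep n k i hi σ (ψ h) := by
    intro σ h
    have hraise := (commute_relabel_raise (R := ℂ) (permNat_smul_range σ)).pow_right m
    have hadjoin := commute_relabel_adjoin (R := ℂ)
      (permNat_smul_of_le σ fun x hx => (mem_Ico.1 (hw hx)).1)
    simp only [ψ, LinearMap.comp_apply, stageRep_restrict, extend_permRep]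
    refine congrArg _ (Eq.trans (congrArg _ ?_) (LinearMap.congr_fun hadjoin.eq _).symm)
    exact (LinearMap.congr_fun hraise.eq _).symm
  let φ : (specht i a).toRepresentation.IntertwiningMap (stageRep n k i hi) :=
    (ψ ∘ₗ (specht i a).toSubmodule.subtype).intertwiningMap_of_isIntertwiningMap _ _
      fun σ v => hψ σ v
  have hinj : Function.Injective φ.toLinearMap := by
    rw [injective_iff_map_eq_zero]
    intro v hv
    refine Subtype.ext ?_
    rw [← restrict_extend v.1, eq_zero_of_restrict_adjoin_raise_pow_eq_zero hi hm hw hk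
      (extend_mem_pairSpan ha v.2) hv, map_zero, Submodule.coe_zero]
  rw [← map_extend_specht ha] at hf
  obtain ⟨h, hh, rfl⟩ := hf
  exact Submodule.mem_iSup_of_mem φ (Submodule.mem_iSup_of_mem hinj ⟨⟨h, hh⟩, rfl⟩)

end Isotypic

/-! ### Vectors with given labels -/

namespace Label

variable {n k i : ℕ} (l : Label n k i)

theorem secondLength_eq_count (j : ℕ) :
    l.secondLength j = Nat.count (· ∈ l.second.map Fin.valEmbedding) j := by
  rw [secondLength, Nat.count_eq_card_filter_range, ← card_map Fin.valEmbedding]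
  congr 1
  ext x
  simp only [mem_map, mem_filter, mem_range, Fin.valEmbedding_apply]
  grind

theorem secondLength_self : l.secondLength i = #l.second := by
  rw [secondLength, filter_true_of_mem l.second_lt]

theorem two_mul_card_second_le : 2 * #l.second ≤ i := by
  linarith [l.shape_le, l.shape_le']

/-- A vector spanning the line of the functions with the label `l`: the Gelfand-Tsetlin vector of
the tableau on the first `i` places, raised to the right number of letters `1`, times the delta
function of the word. -/
def vec : FunSpace n k :=
  restrict n k (adjoin (l.ones.map Fin.valEmbedding)
    ((raise (range i) ^ (k - #l.ones - #l.second)) (gtVec ℂ (l.second.map Fin.valEmbedding) i)))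

theorem map_ones_subset : l.ones.map Fin.valEmbedding ⊆ Ico i n := by
  intro x hx
  obtain ⟨y, hy, rfl⟩ := mem_map.1 hx
  exact mem_Ico.2 ⟨l.le_ones y hy, y.isLt⟩

theorem gtVec_second_mem_pairSpan :
    gtVec ℂ (l.second.map Fin.valEmbedding) i ∈ pairSpan ℂ (range i) #l.second := by
  rw [← l.secondLength_self, secondLength_eq_count]
  exact gtVec_mem_pairSpan _ _

theorem two_mul_card_second_add_le : 2 * #l.second + (k - #l.ones - #l.second) ≤ i := by
  have := l.shape_le
  have := l.shape_le'
  omega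

theorem card_second_add_card_ones :
    #l.second + (k - #l.ones - #l.second) + #(l.ones.map Fin.valEmbedding) = k := by
  have := l.shape_le
  rw [card_map]
  omega

theorem vec_mem_isotypic (hi : i ≤ n) : l.vec ∈ isotypic n k i hi #l.second :=
  restrict_adjoin_raise_pow_mem_isotypic hi l.two_mul_card_second_add_le l.map_ones_subset
    l.card_second_add_card_ones l.gtVec_second_mem_pairSpan

theorem vec_ne_zero (hi : i ≤ n) : l.vec ≠ 0 := fun h =>
  gtVec_ne_zero (fun j hj => by rw [← secondLength_eq_count]; exact l.standard j hj)
    (eq_zero_of_restrict_adjoin_raise_pow_eq_zero hi l.two_mul_card_second_add_le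
      l.map_ones_subset l.card_second_add_card_ones l.gtVec_second_mem_pairSpan h)

theorem vec_mem_stageEigenspace (hi : i ≤ n) {j : ℕ} (hj : j ≤ i) :
    l.vec ∈ stageEigenspace n k j (hj.trans hi) (l.secondLength j) := by
  have hdisj : Disjoint (range j) (l.ones.map Fin.valEmbedding) := disjoint_left.2 fun x hx hxw =>
    ((mem_range.1 hx).trans_le hj).not_ge (mem_Ico.1 (l.map_ones_subset hxw)).1
  have hcomm : Commute (swapSum (range j)) (adjoin (l.ones.map Fin.valEmbedding) *
      (raise (range i) : Module.End ℂ _) ^ (k - #l.ones - #l.second)) :=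
    (commute_swapSum_adjoin hdisj).mul_right
      ((commute_swapSum_raise (range_subset_range.2 hj)).pow_right _)
  rw [stageEigenspace, Module.End.mem_eigenspace_iff, vec, repSwapSum_stageRep_restrict,
    ← Module.End.mul_apply (adjoin _), ← Module.End.mul_apply, hcomm.eq, Module.End.mul_apply,
    swapSum_gtVec _ hj, map_smul, map_smul, secondLength_eq_count]

theorem mem_wordSpace {l : Label n k i} {f : FunSpace n k} :
    f ∈ l.wordSpace ↔
      ∀ x : KSet n k, f x ≠ 0 → ∀ y : Fin n, i ≤ (y : ℕ) → (y ∈ x ↔ y ∈ l.ones) := by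
  have hdelta : (delta : KSet n k → FunSpace n k) = (EuclideanSpace.basisFun _ ℂ).toBasis := by
    funext x
    simp only [delta, OrthonormalBasis.coe_toBasis, EuclideanSpace.basisFun_apply]
  rw [wordSpace, hdelta, Module.Basis.mem_span_image]
  simp [Set.subset_def]

theorem vec_mem_wordSpace : l.vec ∈ l.wordSpace := by
  rw [mem_wordSpace]
  intro x hx y hy
  have hslice := adjoin_mem_sliceSpace (w := l.ones.map Fin.valEmbedding)
    (raise_pow_mem_sliceSpace (pairSpan_le_sliceSpace _ _ l.gtVec_second_mem_pairSpan)
      (k - #l.ones - #l.second))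
  rw [vec, restrict_apply] at hx
  have hsub := (hslice _ hx).1
  rw [adjoin_apply, ite_ne_right_iff] at hx
  rw [← mem_map' (s := l.ones) Fin.valEmbedding, ← Set.powersetCard.mem_coe_iff,
    ← mem_map' (s := (x : Finset (Fin n))) Fin.valEmbedding]
  exact ⟨fun h => (mem_union.1 (hsub h)).resolve_left fun h' => hy.not_gt (mem_range.1 h'),
    fun h => hx.1 h⟩

theorem ext_of_secondLength {l l' : Label n k i}
    (h : ∀ j ≤ i, l.secondLength j = l'.secondLength j) (h' : l.ones = l'.ones) : l = l' := by
  refine ext_pair (Prod.ext ?_ h')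
  ext x
  by_cases hx : (x : ℕ) < i
  · have hlt := h x hx.le
    have hle := h (x + 1) hx
    simp only [secondLength_eq_count, Nat.count_succ] at hlt hle
    rw [hlt, Nat.add_left_cancel_iff] at hle
    rw [← mem_map' (s := l.second) Fin.valEmbedding, ← mem_map' (s := l'.second) Fin.valEmbedding,
      Fin.valEmbedding_apply]
    grind
  · exact iff_of_false (fun hl => hx (l.second_lt x hl)) fun hl => hx (l'.second_lt x hl)

theorem inner_eq_zero_of_mem_wordSpace {i' : ℕ} {l : Label n k i} {l' : Label n k i'}
    {f g : FunSpace n k} (hf : f ∈ l.wordSpace) (hg : g ∈ l'.wordSpace) {y : Fin n}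
    (hi : i ≤ (y : ℕ)) (hi' : i' ≤ (y : ℕ)) (hy : ¬ (y ∈ l.ones ↔ y ∈ l'.ones)) :
    inner ℂ f g = 0 := by
  rw [PiLp.inner_apply]
  refine sum_eq_zero fun x _ => ?_
  by_cases hfx : f x = 0
  · rw [hfx, inner_zero_left]
  · by_cases hgx : g x = 0
    · rw [hgx, inner_zero_right]
    · exact absurd ((mem_wordSpace.1 hf x hfx y hi).symm.trans (mem_wordSpace.1 hg x hgx y hi')) hy

theorem inner_vec_of_ne (hi : i ≤ n) {l l' : Label n k i} (h : l ≠ l') :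
    inner ℂ l.vec l'.vec = 0 := by
  by_cases hones : l.ones = l'.ones
  · obtain ⟨j, hj, hne⟩ : ∃ j ≤ i, l.secondLength j ≠ l'.secondLength j := by
      by_contra! hall
      exact h (ext_of_secondLength hall hones)
    exact (stageEigenspace_isOrtho (hj.trans hi) (l.standard j hj) (l'.standard j hj) hne).inner_eq
      (l.vec_mem_stageEigenspace hi hj) (l'.vec_mem_stageEigenspace hi hj)
  · obtain ⟨y, hy⟩ : ∃ y, ¬ (y ∈ l.ones ↔ y ∈ l'.ones) := by
      by_contra! hall
      exact hones (Finset.ext hall)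
    have hyi : i ≤ (y : ℕ) := by
      by_contra hlt
      exact hy (iff_of_false (fun h => hlt (l.le_ones y h)) fun h => hlt (l'.le_ones y h))
    exact inner_eq_zero_of_mem_wordSpace l.vec_mem_wordSpace l'.vec_mem_wordSpace hyi hyi hy

/-! ### The number of labels -/

variable (hi : i < n)

/-- The second row of the tableau of `push`. -/
def pushSecond : Finset (Fin n) :=
  if ⟨i, hi⟩ ∉ l.ones ∧ #l.second + #l.ones < k then insert ⟨i, hi⟩ l.second else l.second

theorem notMem_second : (⟨i, hi⟩ : Fin n) ∉ l.second := fun h => (l.second_lt _ h).false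

theorem erase_pushSecond : (l.pushSecond hi).erase ⟨i, hi⟩ = l.second := by
  rw [pushSecond]
  split_ifs
  · exact erase_insert (l.notMem_second hi)
  · exact erase_eq_of_notMem (l.notMem_second hi)

theorem filter_pushSecond {j : ℕ} (hj : j ≤ i) :
    (l.pushSecond hi).filter (fun x : Fin n => (x : ℕ) < j) =
      l.second.filter fun x : Fin n => (x : ℕ) < j := by
  rw [← l.erase_pushSecond hi, filter_erase, erase_eq_of_notMem]
  exact fun h => hj.not_gt (mem_filter.1 h).2

theorem card_pushSecond : #(l.pushSecond hi) =
    if ⟨i, hi⟩ ∉ l.ones ∧ #l.second + #l.ones < k then #l.second + 1 else #l.second := by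
  rw [pushSecond, apply_ite card, card_insert_of_notMem (l.notMem_second hi)]

theorem card_pushSecond_add_card_erase_le :
    #(l.pushSecond hi) + #(l.ones.erase ⟨i, hi⟩) ≤ k := by
  have := l.shape_le
  rw [card_pushSecond, card_erase_eq_ite]
  grind

theorem card_pushSecond_add_le :
    #(l.pushSecond hi) + k ≤ i + 1 + #(l.ones.erase ⟨i, hi⟩) := by
  have := l.shape_le'
  have := card_erase_add_one (s := l.ones) (a := ⟨i, hi⟩)
  rw [card_pushSecond, card_erase_eq_ite] at *
  grind

/-- The label obtained by moving the first place of the word of `l` into the tableau. It goes to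
the second row if it has the letter `2` and `a < r`, in the notation of `Label`, and to the first
row otherwise. -/
def push : Label n k (i + 1) where
  second := l.pushSecond hi
  ones := l.ones.erase ⟨i, hi⟩
  second_lt x hx := by
    by_cases h : x = ⟨i, hi⟩
    · exact h ▸ i.lt_succ_self
    · refine (l.second_lt x ?_).trans i.lt_succ_self
      rw [← l.erase_pushSecond hi]
      exact mem_erase.2 ⟨h, hx⟩
  le_ones x hx := by
    obtain ⟨hne, hx⟩ := mem_erase.1 hx
    exact (l.le_ones x hx).lt_of_ne fun h => hne (Fin.ext h.symm)
  standard j hj := by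
    rcases Nat.of_le_succ hj with h | rfl
    · rw [filter_pushSecond _ _ h]
      exact l.standard j h
    · have := card_filter_le (l.pushSecond hi) fun x : Fin n => (x : ℕ) < i.succ
      have := l.card_pushSecond_add_card_erase_le hi
      have := l.card_pushSecond_add_le hi
      omega
  shape_le := l.card_pushSecond_add_card_erase_le hi
  shape_le' := l.card_pushSecond_add_le hi

theorem mem_ones_iff_push : ⟨i, hi⟩ ∈ l.ones ↔
    ⟨i, hi⟩ ∉ (l.push hi).second ∧ #(l.push hi).second + #(l.push hi).ones < k := by
  have := l.shape_le
  have := l.notMem_second hi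
  have := card_erase_add_one (s := l.ones) (a := ⟨i, hi⟩)
  have hsecond : ⟨i, hi⟩ ∈ l.pushSecond hi ↔ ⟨i, hi⟩ ∉ l.ones ∧ #l.second + #l.ones < k := by
    grind [pushSecond]
  simp only [push, hsecond, card_pushSecond, card_erase_eq_ite]
  grind

theorem push_injective : Function.Injective fun l : Label n k i => l.push hi := by
  intro l l' h
  have hmem : ⟨i, hi⟩ ∈ l.ones ↔ ⟨i, hi⟩ ∈ l'.ones := by
    rw [mem_ones_iff_push, mem_ones_iff_push, show l.push hi = l'.push hi from h]
  have hones : l.ones.erase ⟨i, hi⟩ = l'.ones.erase ⟨i, hi⟩ := congrArg ones h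
  have hsecond : l.pushSecond hi = l'.pushSecond hi := congrArg second h
  refine ext_pair (Prod.ext_iff.2 ⟨?_, ?_⟩) <;> dsimp only
  · rw [← l.erase_pushSecond hi, ← l'.erase_pushSecond hi, hsecond]
  · by_cases hp : ⟨i, hi⟩ ∈ l.ones
    · rw [← insert_erase hp, ← insert_erase (hmem.1 hp), hones]
    · rwa [erase_eq_of_notMem hp, erase_eq_of_notMem (mt hmem.2 hp)] at hones

theorem choose_le_card (k : ℕ) (hi : i ≤ n) : n.choose k ≤ Fintype.card (Label n k i) := by
  induction i with
  | zero =>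
    rw [← card_kset]
    let word (x : KSet n k) : Label n k 0 :=
      { second := ∅, ones := x, second_lt := by simp, le_ones := by simp, standard := by simp
        shape_le := by simp, shape_le' := by simp }
    exact Fintype.card_le_of_injective word fun x x' h => Subtype.ext (congrArg ones h)
  | succ i ih => exact (ih (by omega)).trans (Fintype.card_le_of_injective _ (push_injective hi))

end Label

/-! ### Bases of vectors with given labels -/

theorem kset_ext_of_one_le {n k : ℕ} {x x' : KSet n k}
    (h : ∀ y : Fin n, 1 ≤ (y : ℕ) → (y ∈ x ↔ y ∈ x')) : x = x' := by
  refine Set.powersetCard.eq_iff_subset.2 fun z hz => ?_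
  by_contra hz'
  have hsub : (x' : Finset (Fin n)) ⊆ (x : Finset (Fin n)).erase z := fun y hy => by
    have hyz : y ≠ z := fun h => hz' (h ▸ hy)
    refine mem_erase.2 ⟨hyz, (h y ?_).2 hy⟩
    by_contra hy0
    have hz0 : ¬ 1 ≤ (z : ℕ) := fun h' => hz' ((h z h').1 hz)
    exact hyz (Fin.ext (by omega))
  have := card_le_card hsub
  have := card_erase_add_one hz
  simp only [Set.powersetCard.card_eq] at *
  omega

namespace Label

variable {n k i : ℕ}

theorem exists_eq_smul_delta {l : Label n k 1} {f : FunSpace n k} (hf : f ∈ l.wordSpace)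
    (h : f ≠ 0) : ∃ x, f = f x • delta x := by
  rw [mem_wordSpace] at hf
  obtain ⟨x, hx⟩ : ∃ x, f x ≠ 0 := by
    by_contra! hzero
    exact h (PiLp.ext hzero)
  refine ⟨x, PiLp.ext fun y => ?_⟩
  by_cases hxy : y = x
  · simp [hxy, delta]
  · have hy : f y = 0 := by
      by_contra hy
      exact hxy (kset_ext_of_one_le fun z hz => (hf y hy z hz).trans (hf x hx z hz).symm)
    simp [delta, hxy, hy]

theorem exists_unit_mem_span_vec (hi : i ≤ n) (l : Label n k i) :
    ∃ u ∈ ℂ ∙ l.vec, ‖u‖ = 1 ∧ (i = 1 → ∃ x, u = delta x) := by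
  by_cases h : i = 1
  · subst h
    obtain ⟨x, hx⟩ := exists_eq_smul_delta l.vec_mem_wordSpace (l.vec_ne_zero hi)
    have hne : l.vec x ≠ 0 := fun h => l.vec_ne_zero hi (by rw [hx, h, zero_smul])
    refine ⟨delta x, ?_, by simp [delta], fun _ => ⟨x, rfl⟩⟩
    rw [Submodule.mem_span_singleton]
    exact ⟨(l.vec x)⁻¹, (inv_smul_eq_iff₀ hne).2 hx⟩
  · exact ⟨((‖l.vec‖ : ℂ)⁻¹) • l.vec, Submodule.smul_mem _ _ (Submodule.mem_span_singleton_self _),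
      norm_smul_inv_norm (l.vec_ne_zero hi), fun h' => absurd h' h⟩

theorem exists_orthonormalBasis (hi : i ≤ n) :
    ∃ b : OrthonormalBasis (Label n k i) ℂ (FunSpace n k),
      ∀ l, b l ∈ ℂ ∙ l.vec ∧ (i = 1 → ∃ x, b l = delta x) := by
  choose u hspan hnorm hdelta using fun l : Label n k i => l.exists_unit_mem_span_vec hi
  have hu : Orthonormal ℂ u := by
    refine ⟨hnorm, fun l l' h => ?_⟩
    obtain ⟨c, hc⟩ := Submodule.mem_span_singleton.1 (hspan l)
    obtain ⟨c', hc'⟩ := Submodule.mem_span_singleton.1 (hspan l')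
    rw [← hc, ← hc', inner_smul_left, inner_smul_right, inner_vec_of_ne hi h, mul_zero, mul_zero]
  have hcard : Fintype.card (Label n k i) = Module.finrank ℂ (FunSpace n k) := by
    refine le_antisymm hu.linearIndependent.fintype_card_le_finrank ?_
    rw [finrank_euclideanSpace, card_kset]
    exact choose_le_card k hi
  refine ⟨OrthonormalBasis.mk hu
    (hu.linearIndependent.span_eq_top_of_card_eq_finrank' hcard).ge, fun l => ?_⟩
  rw [OrthonormalBasis.coe_mk]
  exact ⟨hspan l, hdelta l⟩

theorem card_eq_choose (k : ℕ) (hi : i ≤ n) : Fintype.card (Label n k i) = n.choose k := by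
  obtain ⟨b, -⟩ := exists_orthonormalBasis (k := k) hi
  rw [← Module.finrank_eq_card_basis b.toBasis, finrank_euclideanSpace, card_kset]

end Label

section Decomposition

variable {n k i a b : ℕ}

theorem isotypic_eq_stageEigenspace (hi : i ≤ n) (ha : 2 * a ≤ i) :
    isotypic n k i hi a = stageEigenspace n k i hi a := by
  refine le_antisymm (isotypic_le_stageEigenspace hi ha) fun f hf => ?_
  obtain ⟨b, hb⟩ := Label.exists_orthonormalBasis (k := k) hi
  rw [← b.sum_repr' f]
  refine sum_mem fun l _ => ?_
  have hl : b l ∈ isotypic n k i hi #l.second :=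
    (Submodule.span_singleton_le_iff_mem _ _).2 (l.vec_mem_isotypic hi) (hb l).1
  by_cases h : #l.second = a
  · exact Submodule.smul_mem _ _ (h ▸ hl)
  · rw [(stageEigenspace_isOrtho hi l.two_mul_card_second_le ha h).inner_eq
      (isotypic_le_stageEigenspace hi l.two_mul_card_second_le hl) hf, zero_smul]
    exact zero_mem _

theorem isotypic_isOrtho {hi : i ≤ n} (ha : 2 * a ≤ i) (hb : 2 * b ≤ i) (hab : a ≠ b) :
    isotypic n k i hi a ⟂ isotypic n k i hi b :=
  (stageEigenspace_isOrtho hi ha hb hab).mono (isotypic_le_stageEigenspace hi ha)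
    (isotypic_le_stageEigenspace hi hb)

theorem Label.vec_mem_space (hi : i ≤ n) (l : Label n k i) : l.vec ∈ l.space hi := by
  refine ⟨?_, l.vec_mem_wordSpace⟩
  simp only [SetLike.mem_coe, Submodule.mem_iInf]
  intro j _ hj
  have hstd : 2 * l.secondLength j ≤ j := l.standard j hj
  rw [isotypic_eq_stageEigenspace (hj.trans hi) hstd]
  exact l.vec_mem_stageEigenspace hi hj

theorem nonempty_intermediateBases (n k : ℕ) : Nonempty (IntermediateBases n k) := by
  choose b hb using fun i : Fin n =>
    Label.exists_orthonormalBasis (n := n) (k := k) (i := i + 1) i.isLt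
  exact ⟨b, fun i l => (Submodule.span_singleton_le_iff_mem _ _).2 (l.vec_mem_space i.isLt)
    (hb i l).1, fun h l => (hb ⟨0, h⟩ l).2 rfl⟩

theorem Label.mem_isotypic_of_mem_space {j : ℕ} (hi : i ≤ n) {l : Label n k i}
    {f : FunSpace n k} (hf : f ∈ l.space hi) (h1 : 1 ≤ j) (hj : j ≤ i) :
    f ∈ isotypic n k j (hj.trans hi) (l.secondLength j) := by
  have := hf.1
  simp only [SetLike.mem_coe, Submodule.mem_iInf] at this
  exact this j h1 hj

theorem Label.card_second_le_min (l : Label n k n) : #l.second ≤ min k (n - k) := by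
  have hones : l.ones = ∅ := eq_empty_of_forall_notMem fun x hx => (l.le_ones x hx).not_gt x.isLt
  have := l.shape_le
  have := l.shape_le'
  rw [hones, card_empty] at *
  omega

theorem IsDecomposition.unique {f : FunSpace n k} {g g' : Fin (min k (n - k) + 1) → FunSpace n k}
    (hg : IsDecomposition f g) (hg' : IsDecomposition f g') : g = g' := by
  ext1 a
  have horth : ∀ b ≠ a, inner ℂ (g a - g' a) (g b - g' b) = 0 := fun b hb =>
    (isotypic_isOrtho (by omega) (by omega) fun h => hb (Fin.ext h.symm)).inner_eq
      (sub_mem (hg.1 a) (hg'.1 a)) (sub_mem (hg.1 b) (hg'.1 b))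
  rw [← sub_eq_zero, ← inner_self_eq_zero (𝕜 := ℂ)]
  calc inner ℂ (g a - g' a) (g a - g' a) = ∑ b, inner ℂ (g a - g' a) (g b - g' b) :=
        (Fintype.sum_eq_single a horth).symm
    _ = 0 := by rw [← inner_sum, sum_sub_distrib, ← hg.2, ← hg'.2, sub_self, inner_zero_right]

/-- The projection of `f` to the span of the basis vectors whose tableau has `a` boxes in the
second row. -/
def component (b : OrthonormalBasis (Label n k n) ℂ (FunSpace n k)) (f : FunSpace n k) (a : ℕ) :
    FunSpace n k :=
  ∑ l with #l.second = a, inner ℂ (b l) f • b l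

theorem isDecomposition_component (hn : 1 ≤ n) (b : OrthonormalBasis (Label n k n) ℂ (FunSpace n k))
    (hb : ∀ l, b l ∈ l.space le_rfl) (f : FunSpace n k) :
    IsDecomposition f fun a : Fin (min k (n - k) + 1) => component b f a := by
  constructor
  · intro a
    refine sum_mem fun l hl => Submodule.smul_mem _ _ ?_
    have := l.mem_isotypic_of_mem_space le_rfl (hb l) hn le_rfl
    rwa [l.secondLength_self, (mem_filter.1 hl).2] at this
  · rw [Fin.sum_univ_eq_sum_range (component b f)]
    conv_lhs => rw [← b.sum_repr' f]
    exact (sum_fiberwise_of_maps_to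
      (fun l _ => mem_range.2 (Nat.lt_succ_of_le l.card_second_le_min)) _).symm

theorem norm_component_sq (b : OrthonormalBasis (Label n k n) ℂ (FunSpace n k))
    (f : FunSpace n k) (a : ℕ) : ((‖component b f a‖ ^ 2 : ℝ) : ℂ) =
      ∑ l with #l.second = a, inner ℂ (b l) f * (starRingEnd ℂ) (inner ℂ (b l) f) := by
  calc ((‖component b f a‖ ^ 2 : ℝ) : ℂ) = inner ℂ (component b f a) (component b f a) := by
        rw [inner_self_eq_norm_sq_to_K, Complex.ofReal_pow]
        rfl
    _ = ∑ l with #l.second = a, (starRingEnd ℂ) (inner ℂ (b l) f) * inner ℂ (b l) f :=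
        b.orthonormal.inner_sum _ _ _
    _ = _ := sum_congr rfl fun l _ => mul_comm _ _

theorem existsUnique_isDecomposition (hn : 1 ≤ n) (f : FunSpace n k) :
    ∃! g, IsDecomposition f g := by
  obtain ⟨m, rfl⟩ := Nat.exists_eq_add_of_le' hn
  obtain ⟨B⟩ := nonempty_intermediateBases (m + 1) k
  have := isDecomposition_component hn (B.basis (Fin.last m)) (B.mem_space (Fin.last m)) f
  exact ⟨_, this, fun g hg => hg.unique this⟩

end Decomposition

/-! ### Straight-line programs -/

/-- The list of the results of a list of operations. -/
def opResults {I : Type} (ops : List (Op I)) (inp : I → ℂ) : List ℂ :=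
  ops.foldl (fun mem c => mem ++ [c.eval inp mem]) []

/-- The operand `o` has the value `val t` for the input `inp t`, for every `t`, after the
operations `ops` and any further ones. -/
def Computes {I ι : Type} (inp : ι → I → ℂ) (ops : List (Op I)) (o : Operand I) (val : ι → ℂ) :
    Prop :=
  ∀ t mem, opResults ops (inp t) <+: mem → o.eval (inp t) mem = val t

section Programs

variable {I ι : Type} {inp : ι → I → ℂ}

theorem opResults_concat (ops : List (Op I)) (c : Op I) (v : I → ℂ) :
    opResults (ops ++ [c]) v = opResults ops v ++ [c.eval v (opResults ops v)] := by
  simp only [opResults, List.foldl_append, List.foldl_cons, List.foldl_nil]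

theorem length_opResults (ops : List (Op I)) (v : I → ℂ) :
    (opResults ops v).length = ops.length := by
  induction ops using List.reverseRecOn with
  | nil => rfl
  | append_singleton ops c ih => simp [opResults_concat, ih]

theorem opResults_prefix {ops ops' : List (Op I)} (h : ops <+: ops') (v : I → ℂ) :
    opResults ops v <+: opResults ops' v := by
  obtain ⟨ops', rfl⟩ := h
  induction ops' using List.reverseRecOn with
  | nil => rw [List.append_nil]
  | append_singleton ops' c ih =>
    rw [← List.append_assoc, opResults_concat]
    exact ih.trans (List.prefix_append _ _)

theorem Computes.mono {ops ops' : List (Op I)} {o : Operand I} {val : ι → ℂ}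
    (h : Computes inp ops o val) (hops : ops <+: ops') : Computes inp ops' o val :=
  fun t mem hmem => h t mem ((opResults_prefix hops _).trans hmem)

theorem computes_concat {ops : List (Op I)} {c : Op I} {val : ι → ℂ}
    (h : ∀ t, c.eval (inp t) (opResults ops (inp t)) = val t) :
    Computes inp (ops ++ [c]) (.result ops.length) val := by
  rintro t _ ⟨mem, rfl⟩
  rw [opResults_concat, h, ← length_opResults ops (inp t)]
  simp [Operand.eval]

theorem exists_computes_sum {L : Type*} (s : Finset L) {ops : List (Op I)} {f : L → ι → ℂ}
    (step : L → Operand I → Op I)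
    (h : ∀ l ∈ s, ∀ o t mem, opResults ops (inp t) <+: mem →
      (step l o).eval (inp t) mem = o.eval (inp t) mem + f l t) :
    ∃ ops', ops <+: ops' ∧ ops'.length = ops.length + #s ∧
      ∃ o, Computes inp ops' o fun t => ∑ l ∈ s, f l t := by
  classical
  induction s using Finset.induction_on with
  | empty => exact ⟨ops, List.prefix_rfl, rfl, .zero, fun _ _ _ => rfl⟩
  | insert l s hl ih =>
    obtain ⟨ops', hops, hlen, o, ho⟩ := ih fun l' hl' => h l' (mem_insert_of_mem hl')
    refine ⟨ops' ++ [step l o], hops.trans (List.prefix_append _ _), ?_, .result ops'.length,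
      computes_concat fun t => ?_⟩
    · rw [List.length_append, List.length_singleton, hlen, card_insert_of_notMem hl, add_assoc]
    · rw [h l (mem_insert_self l s) o t _ (opResults_prefix hops _), ho t _ List.prefix_rfl,
        sum_insert hl, add_comm]

theorem exists_computes_sum_mul {L : Type*} (s : Finset L) {ops : List (Op I)}
    {p q : L → Operand I} {f g : L → ι → ℂ} (hf : ∀ l ∈ s, Computes inp ops (p l) (f l))
    (hg : ∀ l ∈ s, Computes inp ops (q l) (g l)) :
    ∃ ops', ops <+: ops' ∧ ops'.length = ops.length + #s ∧
      ∃ o, Computes inp ops' o fun t => ∑ l ∈ s, f l t * g l t :=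
  exists_computes_sum s (fun l o => .mulAdd o (p l) (q l)) fun l hl o t mem hmem => by
    rw [Op.eval, hf l hl t mem hmem, hg l hl t mem hmem]

theorem exists_computes_sum_normSq {L : Type*} (s : Finset L) {ops : List (Op I)}
    {p : L → Operand I} {f : L → ι → ℂ} (hf : ∀ l ∈ s, Computes inp ops (p l) (f l)) :
    ∃ ops', ops <+: ops' ∧ ops'.length = ops.length + #s ∧
      ∃ o, Computes inp ops' o fun t => ∑ l ∈ s, f l t * (starRingEnd ℂ) (f l t) :=
  exists_computes_sum s (fun l o => .normSqAdd o (p l)) fun l hl o t mem hmem => by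
    rw [Op.eval, hf l hl t mem hmem]

theorem exists_forall_computes {L : Type*} (s : Finset L) {ops : List (Op I)} {c : L → ℕ}
    {f : L → ι → ℂ}
    (h : ∀ l ∈ s, ∀ ops₁, ops <+: ops₁ → ∃ ops₂, ops₁ <+: ops₂ ∧
      ops₂.length ≤ ops₁.length + c l ∧ ∃ o, Computes inp ops₂ o (f l)) :
    ∃ ops', ops <+: ops' ∧ ops'.length ≤ ops.length + ∑ l ∈ s, c l ∧
      ∀ l ∈ s, ∃ o, Computes inp ops' o (f l) := by
  classical
  induction s using Finset.induction_on with
  | empty => exact ⟨ops, List.prefix_rfl, le_rfl, fun _ h => absurd h (notMem_empty _)⟩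
  | insert l s hl ih =>
    obtain ⟨ops₁, hops₁, hlen₁, hs⟩ := ih fun l' hl' => h l' (mem_insert_of_mem hl')
    obtain ⟨ops₂, hops₂, hlen₂, hcomp⟩ := h l (mem_insert_self l s) ops₁ hops₁
    refine ⟨ops₂, hops₁.trans hops₂, ?_, forall_mem_insert .. |>.2 ⟨hcomp, fun l' hl' => ?_⟩⟩
    · rw [sum_insert hl]
      omega
    · obtain ⟨o, ho⟩ := hs l' hl'
      exact ⟨o, ho.mono hops₂⟩

end Programs

/-! ### The algorithm -/

section Neighbors

variable {n k i : ℕ}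

/-- The labels at level `i` of the basis vectors that can occur in the expansion of the basis
vector with the label `l'` at level `i + 1`: the tableaux agree up to `i` and the words agree
except for their first letter. -/
def Label.neighbors (l' : Label n k (i + 1)) : Finset (Label n k i) :=
  open Classical in
  univ.filter fun l => (∀ j ≤ i, l.secondLength j = l'.secondLength j) ∧
    ∀ y : Fin n, i + 1 ≤ (y : ℕ) → (y ∈ l.ones ↔ y ∈ l'.ones)

theorem Label.mem_neighbors {l : Label n k i} {l' : Label n k (i + 1)} : l ∈ l'.neighbors ↔
    (∀ j ≤ i, l.secondLength j = l'.secondLength j) ∧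
      ∀ y : Fin n, i + 1 ≤ (y : ℕ) → (y ∈ l.ones ↔ y ∈ l'.ones) := by
  simp only [neighbors, mem_filter, mem_univ, true_and]

theorem Label.card_neighbors_le_two (hi : i < n) (l' : Label n k (i + 1)) : #l'.neighbors ≤ 2 := by
  rw [← Fintype.card_bool, ← card_univ]
  refine card_le_card_of_injOn (fun l => decide ((⟨i, hi⟩ : Fin n) ∈ l.ones))
    (fun _ _ => mem_univ _) fun l hl m hm h => ?_
  rw [mem_coe, mem_neighbors] at hl hm
  refine ext_of_secondLength (fun j hj => (hl.1 j hj).trans (hm.1 j hj).symm) ?_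
  ext y
  rcases lt_trichotomy (y : ℕ) i with hy | hy | hy
  · exact iff_of_false (fun h => (l.le_ones y h).not_gt hy) fun h => (m.le_ones y h).not_gt hy
  · rw [show y = ⟨i, hi⟩ from Fin.ext hy]
    exact decide_eq_decide.1 h
  · exact (hl.2 y hy).trans (hm.2 y hy).symm

theorem Label.inner_eq_zero_of_notMem_neighbors (hi : i + 1 ≤ n) {l : Label n k i}
    {l' : Label n k (i + 1)} (h : l ∉ l'.neighbors) {f g : FunSpace n k}
    (hf : f ∈ l'.space hi) (hg : g ∈ l.space (i.le_succ.trans hi)) : inner ℂ f g = 0 := by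
  rw [mem_neighbors, not_and_or] at h
  push Not at h
  rcases h with ⟨j, hj, hne⟩ | ⟨y, hy, hne⟩
  · have hj1 : 1 ≤ j := by
      rw [Nat.one_le_iff_ne_zero]
      rintro rfl
      simp [secondLength] at hne
    have hj' := hj.trans i.le_succ
    exact (isotypic_isOrtho (l'.standard j hj') (l.standard j hj) hne.symm).inner_eq
      (l'.mem_isotypic_of_mem_space hi hf hj1 hj') (l.mem_isotypic_of_mem_space _ hg hj1 hj)
  · exact inner_eq_zero_of_mem_wordSpace hf.2 hg.2 hy (i.le_succ.trans hy) (by tauto)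

end Neighbors

section Algorithm

variable {n k : ℕ}

/-- The input of the algorithm, for a pair of a choice of the bases and a function. -/
def inputPair (t : IntermediateBases n k × FunSpace n k) : InputVar n k → ℂ := inputOf t.1 t.2

theorem factor_apply (B : IntermediateBases n k) (i : ℕ) (hi : i + 1 < n)
    (l' : Label n k (i + 1 + 1)) (l : Label n k (i + 1)) :
    B.factor i hi l' l =
      inner ℂ (B.basis ⟨i + 1, hi⟩ l') (B.basis ⟨i, Nat.lt_of_succ_lt hi⟩ l) := by
  rw [IntermediateBases.factor, Module.Basis.toMatrix_apply,
    OrthonormalBasis.coe_toBasis_repr_apply, OrthonormalBasis.repr_apply_apply]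

theorem inner_basis_succ (B : IntermediateBases n k) (f : FunSpace n k) (i : ℕ) (hi : i + 1 < n)
    (l' : Label n k (i + 1 + 1)) :
    inner ℂ (B.basis ⟨i + 1, hi⟩ l') f = ∑ l ∈ l'.neighbors,
      B.factor i hi l' l * inner ℂ (B.basis ⟨i, Nat.lt_of_succ_lt hi⟩ l) f := by
  simp only [factor_apply]
  rw [← (B.basis ⟨i, Nat.lt_of_succ_lt hi⟩).sum_inner_mul_inner (B.basis ⟨i + 1, hi⟩ l') f]
  refine (sum_subset (subset_univ _) fun l _ hl => ?_).symm
  rw [Label.inner_eq_zero_of_notMem_neighbors hi hl (B.mem_space ⟨i + 1, hi⟩ l')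
    (B.mem_space ⟨i, Nat.lt_of_succ_lt hi⟩ l), zero_mul]

theorem inner_delta (x : KSet n k) (f : FunSpace n k) : inner ℂ (delta x) f = f x := by
  simp [delta, EuclideanSpace.inner_single_left]

theorem delta_mem_wordSpace {i : ℕ} {l : Label n k i} {x : KSet n k} (h : delta x ∈ l.wordSpace) :
    ∀ y : Fin n, i ≤ (y : ℕ) → (y ∈ x ↔ y ∈ l.ones) :=
  Label.mem_wordSpace.1 h x (by simp [delta])

theorem exists_computes_inner_basis_zero (hn : 0 < n) (l : Label n k (0 + 1)) :
    ∃ o, Computes (inputPair (n := n) (k := k)) [] o fun t =>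
      inner ℂ (t.1.basis ⟨0, hn⟩ l) t.2 := by
  obtain ⟨B₀⟩ := nonempty_intermediateBases n k
  obtain ⟨x₀, hx₀⟩ := B₀.first hn l
  refine ⟨.input (.coord x₀), fun t mem _ => ?_⟩
  obtain ⟨x, hx⟩ := t.1.first hn l
  have hmem₀ : delta x₀ ∈ l.wordSpace := hx₀ ▸ (B₀.mem_space ⟨0, hn⟩ l).2
  have hmem : delta x ∈ l.wordSpace := hx ▸ (t.1.mem_space ⟨0, hn⟩ l).2
  have hxx₀ : x = x₀ := kset_ext_of_one_le fun y hy =>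
    (delta_mem_wordSpace hmem y hy).trans (delta_mem_wordSpace hmem₀ y hy).symm
  calc t.2 x₀ = inner ℂ (delta x) t.2 := by rw [inner_delta, hxx₀]
    _ = inner ℂ (t.1.basis ⟨0, hn⟩ l) t.2 := by rw [hx]

theorem exists_computes_inner_basis (i : ℕ) (hi : i < n) :
    ∃ ops : List (Op (InputVar n k)), ops.length ≤ 2 * i * n.choose k ∧
      ∀ l, ∃ o, Computes inputPair ops o fun t => inner ℂ (t.1.basis ⟨i, hi⟩ l) t.2 := by
  induction i with
  | zero => exact ⟨[], Nat.zero_le _, exists_computes_inner_basis_zero hi⟩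
  | succ i ih =>
    obtain ⟨ops, hlen, hops⟩ := ih (Nat.lt_of_succ_lt hi)
    choose o ho using hops
    obtain ⟨ops', -, hlen', hops'⟩ := exists_forall_computes (univ : Finset (Label n k (i + 1 + 1)))
      (inp := inputPair) (ops := ops) (c := fun _ => 2)
      (f := fun l' t => inner ℂ (t.1.basis ⟨i + 1, hi⟩ l') t.2) fun l' _ ops₁ hops₁ => by
        obtain ⟨ops₂, hops₂, hlen₂, hcomp⟩ := exists_computes_sum_mul l'.neighbors
          (p := fun l => .input (.entry i hi l' l)) (f := fun l t => t.1.factor i hi l' l)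
          (fun l _ t mem _ => rfl) (fun l _ => (ho l).mono hops₁)
        simp only [← inner_basis_succ] at hcomp
        exact ⟨ops₂, hops₂, hlen₂ ▸ Nat.add_le_add_left (l'.card_neighbors_le_two hi) _, hcomp⟩
    refine ⟨ops', ?_, fun l => hops' l (mem_univ l)⟩
    rw [sum_const, card_univ, Label.card_eq_choose k hi, smul_eq_mul] at hlen'
    linarith

theorem sum_card_second_eq (n k : ℕ) : ∑ a : Fin (min k (n - k) + 1),
    #{l : Label n k n | #l.second = (a : ℕ)} = n.choose k := by
  rw [Fin.sum_univ_eq_sum_range fun a => #{l : Label n k n | #l.second = a},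
    ← card_eq_sum_card_fiberwise fun l _ =>
      mem_coe.2 (mem_range.2 (Nat.lt_succ_of_le l.card_second_le_min)),
    card_univ, Label.card_eq_choose k le_rfl]

theorem exists_computes_norm_component_sq (m k : ℕ) :
    ∃ ops : List (Op (InputVar (m + 1) k)), ops.length ≤ (2 * m + 1) * (m + 1).choose k ∧
      ∀ a : Fin (min k (m + 1 - k) + 1), ∃ o, Computes inputPair ops o fun t =>
        ((‖component (t.1.basis (Fin.last m)) t.2 a‖ ^ 2 : ℝ) : ℂ) := by
  obtain ⟨ops, hlen, hops⟩ := exists_computes_inner_basis (k := k) m m.lt_succ_self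
  choose o ho using hops
  obtain ⟨ops', -, hlen', hops'⟩ := exists_forall_computes
    (univ : Finset (Fin (min k (m + 1 - k) + 1))) (inp := inputPair) (ops := ops)
    (c := fun a => #{l : Label (m + 1) k (m + 1) | #l.second = (a : ℕ)})
    (f := fun a t => ((‖component (t.1.basis (Fin.last m)) t.2 a‖ ^ 2 : ℝ) : ℂ))
    fun a _ ops₁ hops₁ => by
      simp only [norm_component_sq]
      obtain ⟨ops₂, hops₂, hlen₂, hcomp⟩ := exists_computes_sum_normSq
        {l : Label (m + 1) k (m + 1) | #l.second = (a : ℕ)} fun l _ => (ho l).mono hops₁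
      exact ⟨ops₂, hops₂, hlen₂.le, hcomp⟩
  refine ⟨ops', ?_, fun a => hops' a (mem_univ a)⟩
  rw [sum_card_second_eq] at hlen'
  linarith

theorem exists_program_weights (hn : 1 ≤ n) (k : ℕ) :
    ∃ P : Program (InputVar n k) (Fin (min k (n - k) + 1)),
      P.cost ≤ (2 * n - 1) * n.choose k ∧
      ∀ (B : IntermediateBases n k) (f : FunSpace n k) (g : Fin (min k (n - k) + 1) → FunSpace n k),
        IsDecomposition f g → ∀ a, P.run (inputOf B f) a = ((‖g a‖ ^ 2 : ℝ) : ℂ) := by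
  obtain ⟨m, rfl⟩ := Nat.exists_eq_add_of_le' hn
  obtain ⟨ops, hlen, hops⟩ := exists_computes_norm_component_sq m k
  choose out hout using hops
  refine ⟨⟨ops, out⟩, hlen, fun B f g hg a => ?_⟩
  rw [hg.unique (isDecomposition_component hn _ (B.mem_space (Fin.last m)) f)]
  exact hout a (B, f) _ List.prefix_rfl

end Algorithm

end JohnsonFFT

end

theorem mainTheorem4 (n k : ℕ) (hn : 1 ≤ n) (hk : k ≤ n) :
    (∀ f : JohnsonFFT.FunSpace n k, ∃! g, JohnsonFFT.IsDecomposition f g) ∧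
    Nonempty (JohnsonFFT.IntermediateBases n k) ∧
    ∃ P : JohnsonFFT.Program (JohnsonFFT.InputVar n k) (Fin (min k (n - k) + 1)),
      P.cost ≤ (2 * n - 1) * n.choose k ∧
      ∀ (B : JohnsonFFT.IntermediateBases n k) (f : JohnsonFFT.FunSpace n k)
        (g : Fin (min k (n - k) + 1) → JohnsonFFT.FunSpace n k),
        JohnsonFFT.IsDecomposition f g →
        ∀ a, P.run (JohnsonFFT.inputOf B f) a = ((‖g a‖ ^ 2 : ℝ) : ℂ) :=
  ⟨JohnsonFFT.existsUnique_isDecomposition hn, JohnsonFFT.nonempty_intermediateBases n k,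
    JohnsonFFT.exists_program_weights hn k⟩
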